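/- **Theorem 4.4 (Semi-abstract result for nonlocal equations).** Let $H$ be a real Hilbert space with norm $|\cdot|$, and let $A$ be a nonnegative self-adjoint linear operator on $H$ with dense domain $D(A)$. Let $A^{1/2}$ be its nonnegative self-adjoint square root, whose domain $D(A^{1/2})$ is equipped with the norm $|u|_{D(A^{1/2})}=(|u|^2+|A^{1/2}u|^2)^{1/2}$. Assume that $\ker A\neq\{0\}$, that $\dim(\ker A)<+\infty$, and that there exists $\nu>0$ such that $|A^{1/2}u|^2\ge \nu|u|^2$ for every $u\in D(A^{1/2})\cap(\ker A)^{\perp}$. Let $M$ be a closed vector subspace of $H$ such that $M^{\perp}\cap\ker A=\{0\}$, let $P_M:H\to M$ be the orthogonal projection, and let $p>0$. Consider the problem $$u''(t)+u'(t)+Au(t)+|P_Mu(t)|^{p}P_Mu(t)=0\quad(t\ge 0),\qquad u(0)=u_0,\quad u'(0)=u_1 .$$ A global weak solution is a function $u\in C^0([0,+\infty);D(A^{1/2}))\cap C^1([0,+\infty);H)$ that satisfies the initial conditions and such that, for every $\varphi\in D(A^{1/2})$, the function $t\mapsto\langle u'(t),\varphi\rangle$ is differentiable on $[0,+\infty)$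 with $$\frac{d}{dt}\langle u'(t),\varphi\rangle+\langle u'(t),\varphi\rangle+\langle A^{1/2}u(t),A^{1/2}\varphi\rangle+|P_Mu(t)|^{p}\langle P_Mu(t),\varphi\rangle=0\qquad\forall t\ge 0 .$$ Then the following hold. 1. (Decay for all weak solutions) For every $(u_0,u_1)\in D(A^{1/2})\times H$ the problem has a unique global weak solution $u$. Moreover there exists a constant $M_1$ (depending on the solution) such that $|u(t)|\le M_1(1+t)^{-1/p}$ for every $t\ge 0$. 2. (Existence of slow solutions) There exist a nonempty open set $\mathcal S\subseteq D(A^{1/2})\times H$ and constants $M_2>0$, $M_3>0$ such that, for every $(u_0,u_1)\in\mathcal S$, the unique global weak solution of the problem satisfies $$\frac{M_2}{(1+t)^{1/p}}\le|u(t)|\le\frac{M_3}{(1+t)^{1/p}}\qquad\forall t\ge 0 .$$ -/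

import Mathlib

open Set Topology
open scoped RealInnerProductSpace

noncomputable section

namespace DampedWave

variable {H : Type*} [NormedAddCommGroup H] [InnerProductSpace ℝ H]

/-- The kernel of an unbounded operator `A` on `H`, as a subspace of `H`:
`u ∈ ker A` iff `u ∈ D(A)` and `A u = 0`. -/
def opKer (A : H →ₗ.[ℝ] H) : Submodule ℝ H :=
  A.toFun.ker.map A.domain.subtype

theorem mem_opKer {A : H →ₗ.[ℝ] H} {u : H} :
    u ∈ opKer A ↔ ∃ h : u ∈ A.domain, A ⟨u, h⟩ = 0 := by
  constructor
  · rintro ⟨⟨v, hv⟩, h0, rfl⟩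
    exact ⟨hv, h0⟩
  · rintro ⟨h, h0⟩
    exact ⟨⟨u, h⟩, h0, rfl⟩

/-- `A` is nonnegative: `⟨A u, u⟩ ≥ 0` for every `u ∈ D(A)`. -/
def IsNonneg (A : H →ₗ.[ℝ] H) : Prop :=
  ∀ u : A.domain, 0 ≤ ⟪A u, (u : H)⟫

variable [CompleteSpace H]

/-- `B` is a nonnegative self-adjoint square root of `A`. The last field says `A = B ∘ B` as
unbounded operators, the domain of `B ∘ B` being `{u ∈ D(B) | B u ∈ D(B)}`. -/
structure IsNonnegSqrt (A B : H →ₗ.[ℝ] H) : Prop where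
  selfAdjoint : IsSelfAdjoint B
  nonneg : IsNonneg B
  graph_sq : ∀ u w : H, (u, w) ∈ A.graph ↔ ∃ v : H, (u, v) ∈ B.graph ∧ (v, w) ∈ B.graph

/-- The square root `A^{1/2}` of a nonnegative self-adjoint operator `A`: the (classically existing
and unique) nonnegative self-adjoint operator `B` with `B ∘ B = A`. -/
def sqrtOp (A : H →ₗ.[ℝ] H) : H →ₗ.[ℝ] H :=
  Classical.epsilon (IsNonnegSqrt A)

/-- The space `D(A^{1/2})`. It is a separate type, so that it carries the graph norm below
and not the norm of `H`. -/
def SqrtDomain (A : H →ₗ.[ℝ] H) : Type _ := (sqrtOp A).domain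

namespace SqrtDomain

variable (A : H →ₗ.[ℝ] H)

instance : AddCommGroup (SqrtDomain A) := inferInstanceAs (AddCommGroup (sqrtOp A).domain)

instance : Module ℝ (SqrtDomain A) := inferInstanceAs (Module ℝ (sqrtOp A).domain)

/-- The inclusion `D(A^{1/2}) → H`. -/
def toH : SqrtDomain A →ₗ[ℝ] H := (sqrtOp A).domain.subtype

/-- The map `u ↦ A^{1/2} u` on `D(A^{1/2})`. -/
def half : SqrtDomain A →ₗ[ℝ] H := (sqrtOp A).toFun

/-- `u ↦ (u, A^{1/2} u)`, with values in the Hilbert sum `H ⊕ H`. -/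
def toGraph : SqrtDomain A →ₗ[ℝ] WithLp 2 (H × H) :=
  (WithLp.linearEquiv 2 ℝ (H × H)).symm.toLinearMap ∘ₗ (toH A).prod (half A)

theorem toGraph_injective : Function.Injective (toGraph A) := by
  intro u v h
  have h1 := (WithLp.linearEquiv 2 ℝ (H × H)).symm.injective h
  exact Subtype.ext (congrArg Prod.fst h1)

/-- The graph norm `|u|_{D(A^{1/2})} = (|u|² + |A^{1/2} u|²)^{1/2}`. -/
instance : NormedAddCommGroup (SqrtDomain A) :=
  NormedAddCommGroup.induced _ _ (toGraph A) (toGraph_injective A)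

instance : NormedSpace ℝ (SqrtDomain A) :=
  NormedSpace.induced ℝ (SqrtDomain A) (WithLp 2 (H × H)) (toGraph A)

theorem norm_eq (u : SqrtDomain A) :
    ‖u‖ = Real.sqrt (‖toH A u‖ ^ 2 + ‖half A u‖ ^ 2) :=
  WithLp.prod_norm_eq_of_L2 (toGraph A u)

end SqrtDomain

open SqrtDomain

/-- `u` is a global weak solution of `u'' + u' + A u + f(u) = 0`, `u(0) = u₀`, `u'(0) = u₁`, in
`C⁰([0,∞); D(A^{1/2})) ∩ C¹([0,∞); H)`. Here `v` is the derivative `u'` (in `H`), and the equation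
holds when tested with every `φ ∈ D(A^{1/2})`:
`d/dt ⟨u', φ⟩ + ⟨u', φ⟩ + ⟨A^{1/2} u, A^{1/2} φ⟩ + ⟨f(u), φ⟩ = 0` for all `t ≥ 0`.
Only the values of `u` on `[0,∞)` matter; derivatives at `0` are one-sided. -/
def IsWeakSolution (A : H →ₗ.[ℝ] H) (f : H → H) (u₀ : SqrtDomain A) (u₁ : H)
    (u : ℝ → SqrtDomain A) : Prop :=
  ContinuousOn u (Ici 0) ∧
  ∃ v : ℝ → H,
    ContinuousOn v (Ici 0) ∧
    (∀ t : ℝ, 0 ≤ t → HasDerivWithinAt (fun s => toH A (u s)) (v t) (Ici 0) t) ∧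
    u 0 = u₀ ∧
    v 0 = u₁ ∧
    ∀ φ : SqrtDomain A, ∀ t : ℝ, 0 ≤ t →
      HasDerivWithinAt (fun s => ⟪v s, toH A φ⟫)
        (-(⟪v t, toH A φ⟫ + ⟪half A (u t), half A φ⟫ + ⟪f (toH A (u t)), toH A φ⟫)) (Ici 0) t

/-- The nonlinearity `x ↦ |P_M x|^p P_M x`, with `P_M` the orthogonal projection on the closed
subspace `M`. -/
def projNonlinearity (M : ClosedSubmodule ℝ H) (p : ℝ) (x : H) : H :=
  ‖M.toSubmodule.starProjection x‖ ^ p • M.toSubmodule.starProjection x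

end DampedWave

end

/-! Write B = A^{1/2}, P = P_M, w = Bu, v = u'. The energy E = (|v|² + |w|²)/2 + |Pu|^{p+2}/(p+2)
satisfies E' = -|v|².

Well-posedness. B is built from square roots of bounded functions of the resolvent (1 + A)⁻¹
(`exists_isNonnegSqrt`). Bounded approximations of B generate commuting isometric groups, whose
limit solves the linear wave equation (`exists_wave_group`). Conjugating by this group turns the
damped equation with truncated nonlinearity into a Lipschitz ODE; the energy shows that the
truncation is never active (`exists_isDampedWave`). Uniqueness is a Gronwall estimate. Weak
solutions are too rough to be tested with u', so `IsWeakWave.hasDeriv_energy` regularises first.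

Decay. P is injective on the finite-dimensional kernel and A has a gap above it, so |u|² ≤ C₀(|Bu|²
+ |Pu|²) (`exists_sq_norm_le`). The perturbed energy E + σ/(s₀+t)·(⟨u,v⟩ + |u|²/2) with σ = 2 + 2/p
then gives E = O(t^{-(1+2/p)}), and coercivity turns this into |u|² = O(t^{-2/p}).

Slow solutions. Let N project on ker A and F = (|v|² + |w|²)/2 + ε⟨u - Nu, v⟩. Without forcing F
would decay exponentially, and the nonlinearity forces it by at most a multiple of |u|^{2p+2}.
Hence, while u is small, the region F < K|u|^{2p+2} is invariant (`IsDampedWave.modEnergy_lt`).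
Inside it |u'| ≤ 2√K |u|^{p+1}, so |u| cannot decay faster than t^{-1/p}. The region is open and
contains every nonzero kernel vector at rest. -/

open Set Topology
open scoped RealInnerProductSpace

noncomputable section

namespace DampedWave

/-! ### Square roots of 1 - X in a Banach algebra, for ‖X‖ ≤ 1 -/

section BanachAlgebraSqrt

variable {𝔸 : Type*} [NormedRing 𝔸] [NormedAlgebra ℝ 𝔸]

/-- The iteration `Y ↦ (X + Y²) / 2`, whose limit `Y` satisfies `(1 - Y)² = 1 - X`. -/
def sqrtIter (X : 𝔸) : ℕ → 𝔸
  | 0 => 0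
  | n + 1 => (1 / 2 : ℝ) • (X + sqrtIter X n * sqrtIter X n)

theorem sqrtIter_commute {X Z : 𝔸} (h : Commute Z X) (n : ℕ) : Commute Z (sqrtIter X n) := by
  induction n with
  | zero => exact Commute.zero_right Z
  | succ n ih => exact (h.add_right (ih.mul_right ih)).smul_right _

theorem sqrtIter_one_nonneg (n : ℕ) : 0 ≤ sqrtIter (1 : ℝ) n := by
  induction n with
  | zero => exact le_rfl
  | succ n ih => simp only [sqrtIter, smul_eq_mul]; positivity

theorem sqrtIter_one_le (n : ℕ) : sqrtIter (1 : ℝ) n ≤ 1 := by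
  induction n with
  | zero => exact zero_le_one
  | succ n ih =>
    have := sqrtIter_one_nonneg n
    simp only [sqrtIter, smul_eq_mul]; nlinarith

/-- The iterates and their successive differences are polynomials in X with nonnegative
coefficients, so the real iteration at X = 1 majorises both. -/
theorem norm_sqrtIter_le {X : 𝔸} (hX : ‖X‖ ≤ 1) (n : ℕ) : ‖sqrtIter X n‖ ≤ sqrtIter (1 : ℝ) n := by
  induction n with
  | zero => simp [sqrtIter]
  | succ n ih =>
    simp only [sqrtIter, smul_eq_mul, norm_smul]
    rw [Real.norm_of_nonneg (by norm_num)]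
    gcongr
    refine (norm_add_le _ _).trans (add_le_add hX ((norm_mul_le _ _).trans ?_))
    exact mul_le_mul ih ih (norm_nonneg _) (sqrtIter_one_nonneg n)

theorem norm_sqrtIter_succ_sub_le {X : 𝔸} (hX : ‖X‖ ≤ 1) (n : ℕ) :
    ‖sqrtIter X (n + 1) - sqrtIter X n‖ ≤ sqrtIter (1 : ℝ) (n + 1) - sqrtIter (1 : ℝ) n := by
  induction n with
  | zero =>
    simp only [sqrtIter, smul_eq_mul, mul_zero, add_zero, sub_zero, norm_smul]
    rw [Real.norm_of_nonneg (by norm_num)]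
    gcongr
  | succ n ih =>
    set a := sqrtIter X (n + 1) with ha
    set b := sqrtIter X n with hb
    have hcomm : Commute a b :=
      sqrtIter_commute (sqrtIter_commute (Commute.refl X) (n + 1)).symm n
    have h1 : sqrtIter X (n + 1 + 1) - a = (1 / 2 : ℝ) • ((a - b) * (a + b)) := by
      have : (a - b) * (a + b) = a * a - b * b := hcomm.mul_self_sub_mul_self_eq'.symm
      rw [this]
      change (1 / 2 : ℝ) • (X + a * a) - (1 / 2 : ℝ) • (X + b * b) = _
      rw [← smul_sub]; congr 1; abel
    have h2 : sqrtIter (1 : ℝ) (n + 1 + 1) - sqrtIter (1 : ℝ) (n + 1) =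
        1 / 2 * ((sqrtIter (1 : ℝ) (n + 1) - sqrtIter (1 : ℝ) n) *
          (sqrtIter (1 : ℝ) (n + 1) + sqrtIter (1 : ℝ) n)) := by
      simp only [sqrtIter, smul_eq_mul]; ring
    rw [h1, h2, norm_smul, Real.norm_of_nonneg (by norm_num)]
    gcongr
    refine (norm_mul_le _ _).trans (mul_le_mul ih ((norm_add_le _ _).trans
      (add_le_add (norm_sqrtIter_le hX _) (norm_sqrtIter_le hX _))) (norm_nonneg _)
      ((norm_nonneg _).trans ih))

/-- No geometric rate is available when ‖X‖ = 1; the increments are summable because the majorant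
telescopes and stays below 1. -/
theorem exists_tendsto_sqrtIter [CompleteSpace 𝔸] {X : 𝔸} (hX : ‖X‖ ≤ 1) :
    ∃ Y, Filter.Tendsto (sqrtIter X) Filter.atTop (𝓝 Y) := by
  refine cauchySeq_tendsto_of_complete (cauchySeq_of_dist_le_of_summable
    (fun n => sqrtIter (1 : ℝ) (n + 1) - sqrtIter (1 : ℝ) n) (fun n => ?_) ?_)
  · rw [dist_comm, dist_eq_norm]; exact norm_sqrtIter_succ_sub_le hX n
  · refine summable_of_sum_range_le (c := 1)
      (fun n => (norm_nonneg _).trans (norm_sqrtIter_succ_sub_le hX n)) (fun n => ?_)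
    rw [Finset.sum_range_sub]
    have := sqrtIter_one_le n
    simpa [sqrtIter] using this

/-- The limit satisfies 2Y = X + Y², and symmetry and commutation pass to the limit. The bound ‖Y‖ ≤
1 is what later makes 1 - Y a nonnegative operator. -/
theorem exists_sqrt_one_sub [CompleteSpace 𝔸] [StarRing 𝔸] [StarModule ℝ 𝔸] [ContinuousStar 𝔸]
    {X : 𝔸} (hX : ‖X‖ ≤ 1) (hs : IsSelfAdjoint X) :
    ∃ Y : 𝔸, ‖Y‖ ≤ 1 ∧ (1 - Y) * (1 - Y) = 1 - X ∧ IsSelfAdjoint Y ∧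
      ∀ Z, Commute Z X → Commute Z Y := by
  obtain ⟨Y, hY⟩ := exists_tendsto_sqrtIter hX
  refine ⟨Y, ?_, ?_, ?_, fun Z hZ => ?_⟩
  · exact le_of_tendsto hY.norm
      (Filter.Eventually.of_forall fun n => (norm_sqrtIter_le hX n).trans (sqrtIter_one_le n))
  · have h1 : Filter.Tendsto (fun n => sqrtIter X (n + 1)) Filter.atTop
        (𝓝 ((1 / 2 : ℝ) • (X + Y * Y))) := ((hY.mul hY).const_add X).const_smul _
    have h2 := tendsto_nhds_unique ((Filter.tendsto_add_atTop_iff_nat 1).2 hY) h1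
    have h3 : Y + Y = X + Y * Y := by
      conv_lhs => rw [h2]
      rw [← two_smul ℝ, smul_smul]; norm_num
    have : (1 - Y) * (1 - Y) = 1 - (Y + Y) + Y * Y := by noncomm_ring
    rw [this, h3]; abel
  · have h : ∀ n, star (sqrtIter X n) = sqrtIter X n := by
      intro n
      induction n with
      | zero => simp [sqrtIter]
      | succ n ih =>
        simp only [sqrtIter, star_smul, star_add, star_mul, ih, hs.star_eq]
        simp
    have h1 : Filter.Tendsto (fun n => star (sqrtIter X n)) Filter.atTop (𝓝 (star Y)) :=
      (continuous_star.tendsto Y).comp hY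
    simp only [h] at h1
    exact tendsto_nhds_unique h1 hY
  · exact tendsto_nhds_unique (hY.const_mul Z) (by
      have := hY.mul_const Z
      refine this.congr fun n => ?_
      exact (sqrtIter_commute hZ n).eq.symm)

end BanachAlgebraSqrt

/-! ### Self-adjoint unbounded operators and the existence of A^{1/2} -/

section UnboundedOperators

variable {H : Type*} [NormedAddCommGroup H] [InnerProductSpace ℝ H]

/-- The unbounded operator `S x ↦ Q x`. -/
def quotientOp (S Q : H →L[ℝ] H) (hS : Function.Injective S) : H →ₗ.[ℝ] H where
  domain := LinearMap.range (S : H →ₗ[ℝ] H)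
  toFun := (Q : H →ₗ[ℝ] H) ∘ₗ
    (LinearEquiv.ofInjective (S : H →ₗ[ℝ] H) hS).symm.toLinearMap

theorem quotientOp_apply (S Q : H →L[ℝ] H) (hS : Function.Injective S) (x : H)
    (h : S x ∈ (quotientOp S Q hS).domain) : quotientOp S Q hS ⟨S x, h⟩ = Q x := by
  change Q ((LinearEquiv.ofInjective (S : H →ₗ[ℝ] H) hS).symm ⟨S x, h⟩) = Q x
  congr 1
  rw [LinearEquiv.symm_apply_eq]
  ext; simp

theorem mem_graph_quotientOp {S Q : H →L[ℝ] H} {hS : Function.Injective S} {y w : H} :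
    (y, w) ∈ (quotientOp S Q hS).graph ↔ ∃ x, S x = y ∧ Q x = w := by
  rw [LinearPMap.mem_graph_iff]
  constructor
  · rintro ⟨⟨z, x, rfl⟩, h1, h2⟩
    exact ⟨x, h1, (quotientOp_apply S Q hS x _).symm.trans h2⟩
  · rintro ⟨x, rfl, rfl⟩
    exact ⟨⟨S x, x, rfl⟩, rfl, quotientOp_apply S Q hS x _⟩

variable [CompleteSpace H]

/-- This is B* = B in graph form; it reduces membership in the domain to an identity of inner
products. -/
theorem mem_graph_iff_of_isSelfAdjoint {B : H →ₗ.[ℝ] H} (hB : IsSelfAdjoint B) {y w : H} :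
    (y, w) ∈ B.graph ↔ ∀ x : B.domain, ⟪B x, y⟫ = ⟪(x : H), w⟫ := by
  have hd := hB.dense_domain
  have hB' : B.adjoint = B := hB
  have hf := LinearPMap.adjoint_isFormalAdjoint (T := B) hd
  rw [hB'] at hf
  constructor
  · intro h x
    obtain ⟨z, hz, hw⟩ := (LinearPMap.mem_graph_iff _).1 h
    simp only at hz hw
    rw [← hz, ← hw]
    exact hf x z
  · intro h
    have h1 : ∀ x : B.domain, ⟪w, (x : H)⟫ = ⟪y, B x⟫ := fun x => by
      rw [real_inner_comm, ← h x, real_inner_comm]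
    have h2 := LinearPMap.mem_adjoint_domain_of_exists (T := B) y ⟨w, h1⟩
    have h3 := LinearPMap.adjoint_apply_eq (T := B) hd ⟨y, h2⟩ h1
    rw [← hB']
    exact (LinearPMap.mem_graph_iff _).2 ⟨⟨y, h2⟩, rfl, h3⟩

theorem isSelfAdjoint_of_graph {B : H →ₗ.[ℝ] H} (hd : Dense (B.domain : Set H))
    (hsymm : ∀ x x' y y' : H, (x, x') ∈ B.graph → (y, y') ∈ B.graph → ⟪x', y⟫ = ⟪x, y'⟫)
    (h : ∀ y w : H, (∀ x x' : H, (x, x') ∈ B.graph → ⟪x', y⟫ = ⟪x, w⟫) → (y, w) ∈ B.graph) :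
    IsSelfAdjoint B := by
  rw [LinearPMap.isSelfAdjoint_def]
  refine le_antisymm ?_ (LinearPMap.IsFormalAdjoint.le_adjoint hd fun x y =>
    hsymm _ _ _ _ (B.mem_graph x) (B.mem_graph y))
  refine LinearPMap.le_of_le_graph ?_
  rintro ⟨y, w⟩ hyw
  obtain ⟨z, hz, hw⟩ := (LinearPMap.mem_graph_iff _).1 hyw
  simp only at hz hw
  refine h y w fun x x' hx => ?_
  obtain ⟨x, rfl, rfl⟩ := (LinearPMap.mem_graph_iff _).1 hx
  rw [← hz, ← hw, real_inner_comm, real_inner_comm _ (x : H)]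
  exact ((LinearPMap.adjoint_isFormalAdjoint (T := B) hd) z x).symm

theorem dense_range_of_injective_of_isSelfAdjoint {S : H →L[ℝ] H} (hS : Function.Injective S)
    (hs : IsSelfAdjoint S) : Dense (LinearMap.range (S : H →ₗ[ℝ] H) : Set H) := by
  rw [Submodule.dense_iff_topologicalClosure_eq_top, Submodule.topologicalClosure_eq_top_iff,
    Submodule.eq_bot_iff]
  intro y hy
  refine hS ?_
  rw [map_zero, ← inner_self_eq_zero (𝕜 := ℝ)]
  rw [Submodule.mem_orthogonal] at hy
  have := hy (S (S y)) ⟨S y, rfl⟩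
  rwa [hs.isSymmetric.apply_clm (S y) y] at this

/-- A pair (y, w) in the graph of the adjoint satisfies Qy = Sw; since S² + Q² = 1, the vector x =
Sy + Qw then has Sx = y and Qx = w. -/
theorem isSelfAdjoint_quotientOp {S Q : H →L[ℝ] H} (hS : Function.Injective S)
    (hSs : IsSelfAdjoint S) (hQs : IsSelfAdjoint Q) (hc : Commute S Q)
    (h1 : ∀ x, S (S x) + Q (Q x) = x) : IsSelfAdjoint (quotientOp S Q hS) := by
  have hc' : ∀ x, S (Q x) = Q (S x) := fun x => congrArg (fun T : H →L[ℝ] H => T x) hc.eq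
  have hSi : ∀ x y, ⟪S x, y⟫ = ⟪x, S y⟫ := hSs.isSymmetric.apply_clm
  have hQi : ∀ x y, ⟪Q x, y⟫ = ⟪x, Q y⟫ := hQs.isSymmetric.apply_clm
  refine isSelfAdjoint_of_graph (dense_range_of_injective_of_isSelfAdjoint hS hSs) ?_ ?_
  · intro x x' y y' hx hy
    obtain ⟨x, rfl, rfl⟩ := mem_graph_quotientOp.1 hx
    obtain ⟨y, rfl, rfl⟩ := mem_graph_quotientOp.1 hy
    rw [hQi, hSi, hc']
  · intro y w h
    have h2 : Q y = S w := by
      refine ext_inner_left ℝ fun x => ?_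
      rw [← hQi, ← hSi, h _ _ (mem_graph_quotientOp.2 ⟨x, rfl, rfl⟩)]
    refine mem_graph_quotientOp.2 ⟨S y + Q w, ?_, ?_⟩
    · rw [map_add, hc', ← h2, h1]
    · rw [map_add, ← hc', h2, h1]

/-- Here T = (1 + A)⁻¹. On the graph, (x, y) ↦ x + y is bounded below because ⟨x, y⟩ ≥ 0, so its
range is closed; a vector y orthogonal to the range gives (y, -y) in the graph, hence y = 0. -/
theorem exists_resolvent {A : H →ₗ.[ℝ] H} (hA : IsSelfAdjoint A) (hn : IsNonneg A) :
    ∃ T : H →L[ℝ] H, (∀ h, (T h, h - T h) ∈ A.graph) ∧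
      ∀ x y, (x, y) ∈ A.graph → T (x + y) = x := by
  let φ : A.graph →L[ℝ] H :=
    (ContinuousLinearMap.fst ℝ H H + ContinuousLinearMap.snd ℝ H H) ∘L A.graph.subtypeL
  have hφ : ∀ z : A.graph, φ z = (z : H × H).1 + (z : H × H).2 := fun z => rfl
  have hcl : IsClosed (A.graph : Set (H × H)) := hA.isClosed
  have : CompleteSpace A.graph := hcl.completeSpace_coe
  have hbound : ∀ z : A.graph, ‖z‖ ≤ 1 * ‖φ z‖ := by
    rintro ⟨⟨x, y⟩, hz⟩
    have hxy : 0 ≤ ⟪y, x⟫ := by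
      obtain ⟨x, rfl, rfl⟩ := (LinearPMap.mem_graph_iff _).1 hz
      exact hn x
    have h2 : ‖x + y‖ ^ 2 = ‖x‖ ^ 2 + 2 * ⟪x, y⟫ + ‖y‖ ^ 2 := norm_add_sq_real x y
    rw [real_inner_comm] at hxy
    rw [one_mul, hφ]
    change max ‖x‖ ‖y‖ ≤ ‖x + y‖
    refine max_le ?_ ?_ <;> refine le_of_sq_le_sq ?_ (norm_nonneg _) <;>
      nlinarith [sq_nonneg ‖x‖, sq_nonneg ‖y‖]
  have hanti : AntilipschitzWith 1 φ := AddMonoidHomClass.antilipschitz_of_bound φ hbound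
  have hker : LinearMap.ker (φ : A.graph →ₗ[ℝ] H) = ⊥ :=
    LinearMap.ker_eq_bot.2 hanti.injective
  have hrange : LinearMap.range (φ : A.graph →ₗ[ℝ] H) = ⊤ := by
    have hclr : IsClosed (LinearMap.range (φ : A.graph →ₗ[ℝ] H) : Set H) :=
      hanti.isClosed_range φ.uniformContinuous
    rw [← hclr.submodule_topologicalClosure_eq, Submodule.topologicalClosure_eq_top_iff,
      Submodule.eq_bot_iff]
    intro y hy
    rw [Submodule.mem_orthogonal] at hy
    have hg : (y, -y) ∈ A.graph := by
      refine (mem_graph_iff_of_isSelfAdjoint hA).2 fun x => ?_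
      have := hy _ ⟨⟨_, A.mem_graph x⟩, rfl⟩
      change ⟪(x : H) + A x, y⟫ = 0 at this
      rw [inner_add_left] at this
      rw [inner_neg_right]; linarith
    have := hanti.injective (a₁ := ⟨_, hg⟩) (a₂ := 0) (by rw [hφ, map_zero]; simp)
    exact congrArg (fun z : A.graph => (z : H × H).1) this
  let e := ContinuousLinearEquiv.ofBijective φ hker hrange
  have he : ∀ z, e z = φ z := fun z => rfl
  refine ⟨ContinuousLinearMap.fst ℝ H H ∘L A.graph.subtypeL ∘L (e.symm : H →L[ℝ] A.graph),
    fun h => ?_, fun x y hxy => ?_⟩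
  · have h1 : (e.symm h : H × H).1 + (e.symm h : H × H).2 = h := by
      rw [← hφ, ← he, e.apply_symm_apply]
    have h2 : h - (e.symm h : H × H).1 = (e.symm h : H × H).2 :=
      sub_eq_of_eq_add' h1.symm
    change ((e.symm h : H × H).1, h - (e.symm h : H × H).1) ∈ A.graph
    rw [h2]
    exact (e.symm h).2
  · have : e.symm (x + y) = ⟨(x, y), hxy⟩ := by
      rw [ContinuousLinearEquiv.symm_apply_eq]; rfl
    change (e.symm (x + y) : H × H).1 = x
    rw [this]

/-- Since A = (1 - T)T⁻¹ with T the resolvent, the root is B = QS⁻¹ with S = T^{1/2} and Q = (1 -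
T)^{1/2}. -/
theorem exists_isNonnegSqrt {A : H →ₗ.[ℝ] H} (hA : IsSelfAdjoint A) (hn : IsNonneg A) :
    ∃ B, IsNonnegSqrt A B := by
  obtain ⟨T, hT1, hT2⟩ := exists_resolvent hA hn
  have hpos : ∀ h, 0 ≤ ⟪h - T h, T h⟫ := by
    intro h
    obtain ⟨x, hx, hx'⟩ := (LinearPMap.mem_graph_iff _).1 (hT1 h)
    simp only at hx hx'
    rw [← hx', ← hx]; exact hn x
  have hTs : IsSelfAdjoint T := by
    refine LinearMap.IsSymmetric.isSelfAdjoint fun x y => ?_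
    obtain ⟨u, hu, hu'⟩ := (LinearPMap.mem_graph_iff _).1 (hT1 x)
    have := (mem_graph_iff_of_isSelfAdjoint hA).1 (hT1 y) u
    simp only at hu hu'
    rw [hu, hu', inner_sub_left, inner_sub_right] at this
    change ⟪T x, y⟫ = ⟪x, T y⟫
    linarith
  have hTn : ‖T‖ ≤ 1 := by
    refine T.opNorm_le_bound zero_le_one fun h => ?_
    have h1 := hpos h
    rw [inner_sub_left, real_inner_self_eq_norm_sq] at h1
    have h2 := real_inner_le_norm h (T h)
    rw [one_mul]
    by_contra! h3
    nlinarith [norm_nonneg h]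
  have hTn' : ‖1 - T‖ ≤ 1 := by
    refine (1 - T).opNorm_le_bound zero_le_one fun h => ?_
    have h1 := hpos h
    rw [one_mul]
    refine le_of_sq_le_sq ?_ (norm_nonneg _)
    change ‖h - T h‖ ^ 2 ≤ _
    have h2 := norm_add_sq_real (h - T h) (T h)
    rw [sub_add_cancel] at h2
    nlinarith [sq_nonneg ‖T h‖]
  -- 1 - Y is the root of T, 1 - Z the root of 1 - T, and 1 - W the root of 1 - Y; the last one
  -- serves only to prove nonnegativity.
  obtain ⟨Y, hYn, hY, hYs, hYc⟩ := exists_sqrt_one_sub hTn' ((IsSelfAdjoint.one _).sub hTs)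
  obtain ⟨Z, hZn, hZ, hZs, hZc⟩ := exists_sqrt_one_sub hTn hTs
  obtain ⟨W, -, hW, hWs, hWc⟩ := exists_sqrt_one_sub hYn hYs
  have hTY : Commute T Y := hYc T ((Commute.one_right _).sub_right (Commute.refl T))
  have hYZ : Commute Y Z := hZc Y hTY.symm
  have hZW : Commute Z W := hWc Z hYZ.symm
  have hZW' : Commute (1 - Z) (1 - W) :=
    ((Commute.one_left _).sub_left ((Commute.one_right Z).sub_right hZW))
  have hSQ : Commute (1 - Y) (1 - Z) :=
    ((Commute.one_left _).sub_left ((Commute.one_right Y).sub_right hYZ))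
  set S : H →L[ℝ] H := 1 - Y with hSdef
  set Q : H →L[ℝ] H := 1 - Z with hQdef
  have hS2 : ∀ x, S (S x) = T x := fun x => by
    have := congrArg (fun T : H →L[ℝ] H => T x) hY
    simpa using this
  have hQ2 : ∀ x, Q (Q x) = x - T x := fun x => by
    have := congrArg (fun T : H →L[ℝ] H => T x) hZ
    simpa using this
  have hc' : ∀ x, S (Q x) = Q (S x) := fun x => congrArg (fun T : H →L[ℝ] H => T x) hSQ.eq
  have hSs : IsSelfAdjoint S := (IsSelfAdjoint.one _).sub hYs
  have hQs : IsSelfAdjoint Q := (IsSelfAdjoint.one _).sub hZs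
  have hWs' : IsSelfAdjoint (1 - W) := (IsSelfAdjoint.one _).sub hWs
  have hSinj : Function.Injective S := by
    rw [injective_iff_map_eq_zero]
    intro x hx
    have h1 : T x = 0 := by rw [← hS2, hx, map_zero]
    have h2 := hT1 x
    rw [h1] at h2
    simpa using LinearPMap.graph_fst_eq_zero_snd A h2 rfl
  have h1 : ∀ x, S (S x) + Q (Q x) = x := fun x => by rw [hS2, hQ2]; abel
  refine ⟨quotientOp S Q hSinj, isSelfAdjoint_quotientOp hSinj hSs hQs hSQ h1, ?_, ?_⟩
  · intro u
    obtain ⟨x, hx, hx'⟩ := mem_graph_quotientOp.1 ((quotientOp S Q hSinj).mem_graph u)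
    rw [← hx', ← hx]
    -- ⟨Qx, Sx⟩ = ⟨Qy, y⟩ with y = (1 - W)x, and Q = 1 - Z is nonnegative because ‖Z‖ ≤ 1.
    have e1 : S x = (1 - W) ((1 - W) x) := (congrArg (fun T : H →L[ℝ] H => T x) hW).symm
    have e2 : ∀ y, Q ((1 - W) y) = (1 - W) (Q y) :=
      fun y => congrArg (fun T : H →L[ℝ] H => T y) hZW'.eq
    have hWi : ∀ x y, ⟪(1 - W) x, y⟫ = ⟪x, (1 - W) y⟫ := hWs'.isSymmetric.apply_clm
    rw [e1, ← hWi, ← e2]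
    set y := (1 - W) x
    have h2 : ‖Z y‖ ≤ ‖y‖ := by simpa using Z.le_of_opNorm_le hZn y
    have h3 := real_inner_le_norm (Z y) y
    change 0 ≤ ⟪y - Z y, y⟫
    rw [inner_sub_left, real_inner_self_eq_norm_sq]
    nlinarith [norm_nonneg y]
  · intro u w
    constructor
    · intro h
      have h2 := hT2 _ _ h
      refine ⟨S (Q (u + w)), mem_graph_quotientOp.2 ⟨S (u + w), ?_, ?_⟩,
        mem_graph_quotientOp.2 ⟨Q (u + w), rfl, ?_⟩⟩
      · rw [hS2, h2]
      · rw [hc']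
      · rw [hQ2, h2]; abel
    · rintro ⟨v, h2, h3⟩
      obtain ⟨x, rfl, rfl⟩ := mem_graph_quotientOp.1 h2
      obtain ⟨y, hy, rfl⟩ := mem_graph_quotientOp.1 h3
      have h4 : x = S (S x + Q y) := by rw [map_add, hc', hy, h1]
      have h5 := hT1 (S x + Q y)
      rw [← hS2, ← h4] at h5
      simpa using h5

theorem isNonnegSqrt_sqrtOp {A : H →ₗ.[ℝ] H} (hA : IsSelfAdjoint A) (hn : IsNonneg A) :
    IsNonnegSqrt A (sqrtOp A) :=
  Classical.epsilon_spec (exists_isNonnegSqrt hA hn)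

end UnboundedOperators

/-! ### Bounded regularisations of a self-adjoint operator -/

section Regularization

variable {H : Type*} [NormedAddCommGroup H] [InnerProductSpace ℝ H]

/-- Bounded operators `J n → 1`, with range in `D(B)`, that commute with the unbounded operator `B`;
`C n` is the bounded operator `B ∘ J n`. -/
structure IsRegularization (B : H →ₗ.[ℝ] H) (J C : ℕ → H →L[ℝ] H) : Prop where
  inner_J : ∀ n x y, ⟪J n x, y⟫ = ⟪x, J n y⟫
  inner_C : ∀ n x y, ⟪C n x, y⟫ = ⟪x, C n y⟫
  commute_C : ∀ m n, Commute (C m) (C n)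
  commute_J : ∀ m n x, J m (C n x) = C n (J m x)
  norm_J_le : ∀ n x, ‖J n x‖ ≤ 2 * ‖x‖
  mem_graph : ∀ n x, (J n x, C n x) ∈ B.graph
  C_apply : ∀ n x y, (x, y) ∈ B.graph → C n x = J n y
  tendsto_J : ∀ x, Filter.Tendsto (fun n => J n x) Filter.atTop (𝓝 x)

theorem tendsto_zero_of_dense {E F : Type*} [NormedAddCommGroup E] [NormedSpace ℝ E]
    [NormedAddCommGroup F] [NormedSpace ℝ F] {T : ℕ → E →L[ℝ] F} {s : Set E} (hs : Dense s)
    (hT : ∀ n x, ‖T n x‖ ≤ ‖x‖)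
    (h : ∀ x ∈ s, Filter.Tendsto (fun n => T n x) Filter.atTop (𝓝 0)) (x : E) :
    Filter.Tendsto (fun n => T n x) Filter.atTop (𝓝 0) := by
  rw [Metric.tendsto_atTop]
  intro ε hε
  obtain ⟨y, hy, hxy⟩ := Metric.dense_iff.1 hs x (ε / 2) (by positivity)
  rw [Metric.mem_ball, dist_eq_norm] at hy
  obtain ⟨N, hN⟩ := Metric.tendsto_atTop.1 (h y hxy) (ε / 2) (by positivity)
  refine ⟨N, fun n hn => ?_⟩
  have h1 := hN n hn
  rw [dist_zero_right] at h1 ⊢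
  calc ‖T n x‖ = ‖T n y - T n (y - x)‖ := by rw [map_sub]; congr 1; abel
    _ ≤ ‖T n y‖ + ‖T n (y - x)‖ := norm_sub_le _ _
    _ < ε / 2 + ε / 2 := add_lt_add_of_lt_of_le h1 ((hT _ _).trans hy.le)
    _ = ε := by ring

theorem graph_sub {B : H →ₗ.[ℝ] H} {x x' y y' : H}
    (hx : (x, x') ∈ B.graph) (hy : (y, y') ∈ B.graph) : (x - y, x' - y') ∈ B.graph :=
  B.graph.sub_mem hx hy

variable [CompleteSpace H]

theorem inner_graph_of_isSelfAdjoint {B : H →ₗ.[ℝ] H} (hB : IsSelfAdjoint B) {x x' y y' : H}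
    (hx : (x, x') ∈ B.graph) (hy : (y, y') ∈ B.graph) : ⟪x', y⟫ = ⟪x, y'⟫ := by
  obtain ⟨x, rfl, rfl⟩ := (LinearPMap.mem_graph_iff _).1 hx
  exact (mem_graph_iff_of_isSelfAdjoint hB).1 hy x

/-- The operators `R = (1 + B²)⁻¹` and `C = B (1 + B²)⁻¹`. -/
theorem exists_resolvent_sq {B : H →ₗ.[ℝ] H} (hB : IsSelfAdjoint B) :
    ∃ R C : H →L[ℝ] H, ∀ h, (R h, C h) ∈ B.graph ∧ (C h, h - R h) ∈ B.graph := by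
  let L := WithLp.prodContinuousLinearEquiv 2 ℝ H H
  let G : Submodule ℝ (WithLp 2 (H × H)) := B.graph.comap (L : WithLp 2 (H × H) →ₗ[ℝ] H × H)
  have hcl : IsClosed (G : Set (WithLp 2 (H × H))) :=
    IsClosed.preimage L.continuous (show IsClosed (B.graph : Set (H × H)) from hB.isClosed)
  have : CompleteSpace G := hcl.completeSpace_coe
  -- (Rh, Ch) is the orthogonal projection of (h, 0) on the closed graph of B; orthogonality of the
  -- residual to the graph says that B(Ch) = h - Rh.
  let P : H →L[ℝ] H × H := (L : WithLp 2 (H × H) →L[ℝ] H × H) ∘L G.starProjection ∘L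
    (L.symm : H × H →L[ℝ] WithLp 2 (H × H)) ∘L ContinuousLinearMap.inl ℝ H H
  have hP : ∀ h, P h ∈ B.graph := fun h => G.starProjection_apply_mem _
  refine ⟨ContinuousLinearMap.fst ℝ H H ∘L P, ContinuousLinearMap.snd ℝ H H ∘L P,
    fun h => ⟨hP h, ?_⟩⟩
  refine (mem_graph_iff_of_isSelfAdjoint hB).2 fun x => ?_
  have h1 := G.starProjection_inner_eq_zero (L.symm (h, 0)) (L.symm ((x : H), B x))
    (show L (L.symm ((x : H), B x)) ∈ B.graph by
      rw [L.apply_symm_apply]; exact B.mem_graph x)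
  rw [WithLp.prod_inner_apply] at h1
  change ⟪h - (P h).1, (x : H)⟫ + ⟪0 - (P h).2, B x⟫ = 0 at h1
  rw [zero_sub, inner_neg_left, real_inner_comm, real_inner_comm (B x)] at h1
  change ⟪B x, (P h).2⟫ = ⟪(x : H), h - (P h).1⟫
  linarith

/-- With R = (1 + B²)⁻¹ and E = 1 - R, take J n = 1 - Eⁿ = R(1 + E + ⋯ + Eⁿ⁻¹). The factor R maps
into D(B), and everything is a function of R and C = BR, hence commutes. -/
theorem exists_isRegularization {B : H →ₗ.[ℝ] H} (hB : IsSelfAdjoint B) :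
    ∃ J C, IsRegularization B J C := by
  obtain ⟨R, C, hRC⟩ := exists_resolvent_sq hB
  have hg : ∀ {x x' y y' : H}, (x, x') ∈ B.graph → (y, y') ∈ B.graph → ⟪x', y⟫ = ⟪x, y'⟫ :=
    fun hx hy => inner_graph_of_isSelfAdjoint hB hx hy
  have hR : ∀ x y, ⟪R x, y⟫ = ⟪R x, R y⟫ + ⟪C x, C y⟫ := fun x y => by
    rw [hg (hRC x).1 (hRC y).2, inner_sub_right]; ring
  have hRs : ∀ x y, ⟪R x, y⟫ = ⟪x, R y⟫ := fun x y => by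
    rw [hR x y, ← real_inner_comm x, hR y x, real_inner_comm (R x), real_inner_comm (C x)]
  have hCs : ∀ x y, ⟪C x, y⟫ = ⟪x, C y⟫ := fun x y => by
    have h1 := hg (hRC x).1 (hRC y).1
    have h2 := hg (hRC x).2 (hRC y).2
    rw [inner_sub_left, inner_sub_right] at h2
    linarith
  have huniq : ∀ x y z, (x, y) ∈ B.graph → (y, z) ∈ B.graph → R (x + z) = x := by
    intro x y z h1 h2
    have h3 := graph_sub h1 (hRC (x + z)).1
    have h4 := graph_sub h2 (hRC (x + z)).2
    have h5 := hg h3 h4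
    rw [show z - (x + z - R (x + z)) = -(x - R (x + z)) by abel, inner_neg_right,
      real_inner_self_eq_norm_sq, real_inner_self_eq_norm_sq] at h5
    have h6 : ‖x - R (x + z)‖ ^ 2 = 0 := by
      nlinarith [sq_nonneg ‖x - R (x + z)‖, sq_nonneg ‖y - C (x + z)‖]
    rw [pow_eq_zero_iff two_ne_zero, norm_eq_zero, sub_eq_zero] at h6
    exact h6.symm
  have hCR : ∀ x y, (x, y) ∈ B.graph → C x = R y := by
    intro x y h
    have h1 := huniq _ _ _ (hRC x).2 (graph_sub h (hRC x).1)
    rwa [add_sub_cancel, eq_comm] at h1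
  have hcomm : Commute C R := by
    ext x; exact hCR _ _ (hRC x).1
  set E : H →L[ℝ] H := 1 - R with hE
  have hCE : Commute C E := (Commute.one_right C).sub_right hcomm
  have hRE : Commute R E := (Commute.one_right R).sub_right (Commute.refl R)
  let K : ℕ → H →L[ℝ] H := fun n => ∑ k ∈ Finset.range n, E ^ k
  have hK : ∀ {Z : H →L[ℝ] H}, Commute Z E → ∀ n, Commute Z (K n) := fun h n =>
    Commute.sum_right _ _ _ fun k _ => h.pow_right k
  have hEs : IsSelfAdjoint E := by
    refine LinearMap.IsSymmetric.isSelfAdjoint fun x y => ?_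
    change ⟪x - R x, y⟫ = ⟪x, y - R y⟫
    rw [inner_sub_left, inner_sub_right, hRs]
  have hKs : ∀ n, IsSelfAdjoint (K n) := fun n => isSelfAdjoint_sum _ fun k _ => hEs.pow k
  have hKi : ∀ n x y, ⟪K n x, y⟫ = ⟪x, K n y⟫ := fun n => (hKs n).isSymmetric.apply_clm
  have hJ : ∀ n, R * K n = 1 - E ^ n := fun n => by
    have := mul_neg_geom_sum E n
    rwa [hE, sub_sub_cancel] at this
  have hcR : ∀ n x, R (K n x) = K n (R x) := fun n x =>
    congrArg (fun T : H →L[ℝ] H => T x) (hK hRE n).eq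
  have hcC : ∀ n x, C (K n x) = K n (C x) := fun n x =>
    congrArg (fun T : H →L[ℝ] H => T x) (hK hCE n).eq
  have hcK : ∀ m n x, K m (K n x) = K n (K m x) := fun m n x =>
    congrArg (fun T : H →L[ℝ] H => T x)
      (hK (hK (Commute.refl E) m).symm n).eq
  have hcRC : ∀ x, C (R x) = R (C x) := fun x => congrArg (fun T : H →L[ℝ] H => T x) hcomm.eq
  have hEn : ∀ x, ‖E x‖ ^ 2 + ‖R x‖ ^ 2 ≤ ‖x‖ ^ 2 := fun x => by
    have h1 := norm_sub_sq_real x (R x)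
    have h2 := hR x x
    rw [real_inner_self_eq_norm_sq, real_inner_self_eq_norm_sq, real_inner_comm] at h2
    change ‖x - R x‖ ^ 2 + _ ≤ _
    nlinarith [sq_nonneg ‖C x‖]
  have hEn1 : ∀ x, ‖E x‖ ≤ ‖x‖ := fun x =>
    le_of_sq_le_sq (by nlinarith [hEn x, sq_nonneg ‖R x‖]) (norm_nonneg _)
  have hEpow : ∀ n x, (E ^ (n + 1)) x = E ((E ^ n) x) := fun n x => by rw [pow_succ']; rfl
  have hEnn : ∀ n x, ‖(E ^ n) x‖ ≤ ‖x‖ := fun n x => by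
    induction n with
    | zero => simp
    | succ n ih => rw [hEpow]; exact (hEn1 _).trans ih
  have hRinj : Function.Injective R := by
    rw [injective_iff_map_eq_zero]
    intro x hx
    have h1 := (hRC x).1
    rw [hx] at h1
    have h2 := LinearPMap.graph_fst_eq_zero_snd B h1 rfl
    have h3 := (hRC x).2
    rw [h2, hx] at h3
    simpa using LinearPMap.graph_fst_eq_zero_snd B h3 rfl
  have hRsa : IsSelfAdjoint R := LinearMap.IsSymmetric.isSelfAdjoint hRs
  have hElim : ∀ x, Filter.Tendsto (fun n => (E ^ n) x) Filter.atTop (𝓝 0) := by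
    refine tendsto_zero_of_dense (dense_range_of_injective_of_isSelfAdjoint hRinj hRsa) hEnn ?_
    rintro _ ⟨z, rfl⟩
    -- By `hEn`, ‖R Eⁿ z‖² is at most the drop of ‖Eⁿ z‖² at the next step. That sequence decreases
    -- and converges, so the drops tend to 0; the range of R is dense.
    have hanti : Antitone fun n => ‖(E ^ n) z‖ ^ 2 := antitone_nat_of_succ_le fun n => by
      rw [hEpow]; nlinarith [hEn ((E ^ n) z), sq_nonneg ‖R ((E ^ n) z)‖]
    have hlim := tendsto_atTop_ciInf hanti ⟨0, by rintro _ ⟨n, rfl⟩; positivity⟩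
    have hlim2 := hlim.sub ((Filter.tendsto_add_atTop_iff_nat 1).2 hlim)
    rw [sub_self] at hlim2
    have h3 : Filter.Tendsto (fun n => ‖R ((E ^ n) z)‖ ^ 2) Filter.atTop (𝓝 0) := by
      refine squeeze_zero (fun n => by positivity) (fun n => ?_) hlim2
      rw [hEpow]; linarith [hEn ((E ^ n) z)]
    have h4 : ∀ n, (E ^ n) (R z) = R ((E ^ n) z) := fun n =>
      (congrArg (fun T : H →L[ℝ] H => T z) (hRE.pow_right n).eq).symm
    have h5 := h3.sqrt
    simp only [Real.sqrt_zero, Real.sqrt_sq (norm_nonneg _)] at h5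
    rw [tendsto_zero_iff_norm_tendsto_zero]
    exact h5.congr fun n => by rw [← h4]; rfl
  have hJa : ∀ n x, (R * K n) x = x - (E ^ n) x := fun n x => by rw [hJ]; rfl
  refine ⟨fun n => R * K n, fun n => C * K n, ⟨?_, ?_, ?_, ?_, ?_, ?_, ?_, ?_⟩⟩
  · intro n x y
    change ⟪R (K n x), y⟫ = ⟪x, R (K n y)⟫
    rw [hRs, hKi, hcR]
  · intro n x y
    change ⟪C (K n x), y⟫ = ⟪x, C (K n y)⟫
    rw [hCs, hKi, hcC]
  · intro m n
    ext x
    change C (K m (C (K n x))) = C (K n (C (K m x)))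
    rw [← hcC, ← hcC, hcK]
  · intro m n x
    change R (K m (C (K n x))) = C (K n (R (K m x)))
    rw [← hcC, ← hcRC, hcK, hcR n]
  · intro n x
    rw [hJa]
    refine (norm_sub_le _ _).trans ?_
    linarith [hEnn n x]
  · intro n x; exact (hRC (K n x)).1
  · intro n x y h
    change C (K n x) = R (K n y)
    rw [hcC, hCR x y h, hcR]
  · intro x
    simp only [hJa]
    simpa using (hElim x).const_sub x

end Regularization

/-! ### Isometric groups with unbounded skew generators -/

section Group

variable {X : Type*} [NormedAddCommGroup X] [InnerProductSpace ℝ X]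

/-- The one-parameter group generated by a bounded operator. -/
def expGroup (K : X →L[ℝ] X) (t : ℝ) : X →L[ℝ] X := NormedSpace.exp (t • K)

theorem expGroup_zero (K : X →L[ℝ] X) : expGroup K 0 = 1 := by
  simp [expGroup, NormedSpace.exp_zero]

variable [CompleteSpace X]

theorem expGroup_add_of_commute {K L : X →L[ℝ] X} (h : Commute K L) (t : ℝ) :
    expGroup (K + L) t = expGroup K t * expGroup L t := by
  let _ := NormedAlgebra.restrictScalars ℚ ℝ (X →L[ℝ] X)
  rw [expGroup, smul_add, NormedSpace.exp_add_of_commute]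
  · rfl
  · exact (h.smul_left t).smul_right t

theorem expGroup_mul_neg (K : X →L[ℝ] X) (t : ℝ) : expGroup K t * expGroup K (-t) = 1 := by
  let _ := NormedAlgebra.restrictScalars ℚ ℝ (X →L[ℝ] X)
  rw [expGroup, expGroup, ← NormedSpace.exp_add_of_commute]
  · rw [← add_smul]; simp [NormedSpace.exp_zero]
  · exact ((Commute.refl K).smul_left t).smul_right (-t)

theorem hasDerivAt_expGroup (K : X →L[ℝ] X) (x : X) (t : ℝ) :
    HasDerivAt (fun s => expGroup K s x) (K (expGroup K t x)) t :=
  by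
  simpa [expGroup] using (hasDerivAt_exp_smul_const' (𝕂 := ℝ) K t).clm_apply (hasDerivAt_const t x)

theorem hasDerivAt_expGroup' (K : X →L[ℝ] X) (x : X) (t : ℝ) :
    HasDerivAt (fun s => expGroup K s x) (expGroup K t (K x)) t :=
  by
  simpa [expGroup] using (hasDerivAt_exp_smul_const (𝕂 := ℝ) K t).clm_apply (hasDerivAt_const t x)

theorem inner_expGroup {K : X →L[ℝ] X} (hK : ∀ x y, ⟪K x, y⟫ = -⟪x, K y⟫) (t : ℝ) (x y : X) :
    ⟪expGroup K t x, expGroup K t y⟫ = ⟪x, y⟫ := by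
  have h : ∀ s, HasDerivAt (fun s => ⟪expGroup K s x, expGroup K s y⟫) 0 s := fun s => by
    have := (hasDerivAt_expGroup K x s).inner ℝ (hasDerivAt_expGroup K y s)
    rwa [hK, add_neg_cancel] at this
  have := is_const_of_deriv_eq_zero (fun s => (h s).differentiableAt) (fun s => (h s).deriv) t 0
  simpa [expGroup_zero] using this

theorem norm_expGroup {K : X →L[ℝ] X} (hK : ∀ x y, ⟪K x, y⟫ = -⟪x, K y⟫) (t : ℝ) (x : X) :
    ‖expGroup K t x‖ = ‖x‖ := by
  rw [← sq_eq_sq₀ (norm_nonneg _) (norm_nonneg _), ← real_inner_self_eq_norm_sq,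
    ← real_inner_self_eq_norm_sq, inner_expGroup hK]

theorem norm_expGroup_sub_le {K : X →L[ℝ] X} (hK : ∀ x y, ⟪K x, y⟫ = -⟪x, K y⟫) (s t : ℝ) (x : X) :
    ‖expGroup K t x - expGroup K s x‖ ≤ ‖K x‖ * ‖t - s‖ :=
  convex_univ.norm_image_sub_le_of_norm_hasDerivWithin_le
    (fun r _ => (hasDerivAt_expGroup' K x r).hasDerivWithinAt)
    (fun r _ => (norm_expGroup hK r _).le) (mem_univ s) (mem_univ t)

/-- Commutation gives exp(tK) = exp(tL) exp(t(K - L)), with isometric factors. The bound involves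
only (K - L)x and no operator norm, so it survives unbounded limits. -/
theorem norm_expGroup_sub_expGroup_le {K L : X →L[ℝ] X} (hK : ∀ x y, ⟪K x, y⟫ = -⟪x, K y⟫)
    (hL : ∀ x y, ⟪L x, y⟫ = -⟪x, L y⟫) (hc : Commute K L) (t : ℝ) (x : X) :
    ‖expGroup K t x - expGroup L t x‖ ≤ ‖K x - L x‖ * ‖t‖ := by
  have h1 : expGroup K t = expGroup L t * expGroup (K - L) t := by
    rw [← expGroup_add_of_commute (hc.symm.sub_right (Commute.refl L)), add_sub_cancel]
  have h2 : expGroup K t x - expGroup L t x =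
      expGroup L t (expGroup (K - L) t x - expGroup (K - L) 0 x) := by
    rw [h1, expGroup_zero, map_sub]; rfl
  rw [h2, norm_expGroup hL]
  have h3 : ∀ x y, ⟪(K - L) x, y⟫ = -⟪x, (K - L) y⟫ := fun x y => by
    change ⟪K x - L x, y⟫ = -⟪x, K y - L y⟫
    rw [inner_sub_left, inner_sub_right, hK, hL]; ring
  simpa using norm_expGroup_sub_le h3 0 t x

/-- A Stone-type construction: exp(t L n)x is Cauchy for x in D by the previous estimate, and for
every x by density and isometry. -/
theorem exists_group {L : ℕ → X →L[ℝ] X} (hL : ∀ n x y, ⟪L n x, y⟫ = -⟪x, L n y⟫)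
    (hc : ∀ m n, Commute (L m) (L n)) {D : Set X} (hD : Dense D) {l : X → X}
    (hl : ∀ x ∈ D, Filter.Tendsto (fun n => L n x) Filter.atTop (𝓝 (l x))) :
    ∃ U : ℝ → X →L[ℝ] X, (∀ x, U 0 x = x) ∧ (∀ t x, ‖U t x‖ = ‖x‖) ∧
      (∀ t x, U t (U (-t) x) = x) ∧ (∀ t x y, ⟪U t x, y⟫ = ⟪x, U (-t) y⟫) ∧
      (∀ x, Continuous fun t => U t x) ∧
      ∀ x ∈ D, ∀ t, HasDerivAt (fun s => U s x) (U t (l x)) t := by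
  have hlim : ∀ t x, ∃ y, Filter.Tendsto (fun n => expGroup (L n) t x) Filter.atTop (𝓝 y) := by
    intro t x
    refine cauchySeq_tendsto_of_complete (Metric.cauchySeq_iff.2 fun ε hε => ?_)
    obtain ⟨y, hy, hxy⟩ := Metric.dense_iff.1 hD x (ε / 3) (by positivity)
    rw [Metric.mem_ball, dist_eq_norm] at hy
    obtain ⟨N, hN⟩ := Metric.cauchySeq_iff.1 (hl y hxy).cauchySeq (ε / 3 / (‖t‖ + 1)) (by positivity)
    refine ⟨N, fun m hm n hn => ?_⟩
    have h1 := hN m hm n hn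
    rw [dist_eq_norm, lt_div_iff₀ (by positivity)] at h1
    have h2 := norm_expGroup_sub_expGroup_le (hL m) (hL n) (hc m n) t y
    have h3 : ‖L m y - L n y‖ * ‖t‖ < ε / 3 := by nlinarith [norm_nonneg (L m y - L n y)]
    have h4 : expGroup (L m) t x - expGroup (L n) t x = (expGroup (L m) t y - expGroup (L n) t y)
        - (expGroup (L m) t (y - x) - expGroup (L n) t (y - x)) := by
      rw [map_sub, map_sub]; abel
    rw [dist_eq_norm, h4]
    have h5 := norm_sub_le (expGroup (L m) t y - expGroup (L n) t y)
      (expGroup (L m) t (y - x) - expGroup (L n) t (y - x))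
    have h6 := norm_sub_le (expGroup (L m) t (y - x)) (expGroup (L n) t (y - x))
    rw [norm_expGroup (hL m), norm_expGroup (hL n)] at h6
    linarith
  choose V hV using hlim
  let U : ℝ → X →L[ℝ] X := fun t =>
    continuousLinearMapOfTendsto (fun n => expGroup (L n) t) (tendsto_pi_nhds.2 (hV t))
  have hU : ∀ t x, Filter.Tendsto (fun n => expGroup (L n) t x) Filter.atTop (𝓝 (U t x)) := hV
  have hnorm : ∀ t x, ‖U t x‖ = ‖x‖ := fun t x => by
    have := (hU t x).norm
    simp only [norm_expGroup (hL _)] at this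
    exact tendsto_nhds_unique this tendsto_const_nhds
  have hUm : ∀ t {x : ℕ → X} {y : X}, Filter.Tendsto x Filter.atTop (𝓝 y) →
      Filter.Tendsto (fun n => expGroup (L n) t (x n)) Filter.atTop (𝓝 (U t y)) := by
    intro t x y h
    have h1 : Filter.Tendsto (fun n => expGroup (L n) t (x n - y)) Filter.atTop (𝓝 0) := by
      rw [tendsto_zero_iff_norm_tendsto_zero]
      simp only [norm_expGroup (hL _)]
      exact tendsto_iff_norm_sub_tendsto_zero.1 h
    have h2 := h1.add (hU t y)
    rw [zero_add] at h2
    exact h2.congr fun n => by rw [← map_add, sub_add_cancel]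
  have hinv : ∀ t x, U t (U (-t) x) = x := fun t x => by
    have h := hUm t (hU (-t) x)
    have h2 : ∀ n, expGroup (L n) t (expGroup (L n) (-t) x) = x := fun n =>
      congrArg (fun T : X →L[ℝ] X => T x) (expGroup_mul_neg (L n) t)
    simp only [h2] at h
    exact tendsto_nhds_unique h tendsto_const_nhds
  have hinner : ∀ t x y, ⟪U t x, U t y⟫ = ⟪x, y⟫ := fun t x y => by
    have := (hU t x).inner (𝕜 := ℝ) (hU t y)
    simp only [inner_expGroup (hL _)] at this
    exact tendsto_nhds_unique this tendsto_const_nhds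
  have hlip : ∀ x ∈ D, ∀ s t, ‖U t x - U s x‖ ≤ ‖l x‖ * ‖t - s‖ := fun x hx s t =>
    le_of_tendsto_of_tendsto ((hU t x).sub (hU s x)).norm ((hl x hx).norm.mul_const _)
      (Filter.Eventually.of_forall fun n => norm_expGroup_sub_le (hL n) s t x)
  have hcontD : ∀ x ∈ D, Continuous fun t => U t x := fun x hx => by
    refine (LipschitzWith.of_dist_le_mul (K := ‖l x‖₊) fun s t => ?_).continuous
    rw [dist_eq_norm, dist_eq_norm]
    exact hlip x hx t s
  have hcont : ∀ x, Continuous fun t => U t x := fun x => by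
    refine continuous_of_uniform_approx_of_continuous fun u hu => ?_
    obtain ⟨ε, hε, hεu⟩ := Metric.mem_uniformity_dist.1 hu
    obtain ⟨y, hy, hxy⟩ := Metric.dense_iff.1 hD x ε hε
    refine ⟨_, hcontD y hxy, fun t => hεu ?_⟩
    rw [dist_eq_norm, ← map_sub, hnorm, ← dist_eq_norm, dist_comm]
    exact hy
  refine ⟨U, fun x => ?_, hnorm, hinv, fun t x y => ?_, hcont, fun x hx t => ?_⟩
  · have := hU 0 x
    simp only [expGroup_zero] at this
    exact tendsto_nhds_unique this tendsto_const_nhds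
  · rw [← hinner t x, hinv]
  -- Derivatives need not pass to the limit, but their integrated form does.
  · have hint : ∀ t, U t x = x + ∫ s in (0 : ℝ)..t, U s (l x) := fun t => by
      have h1 : ∀ n, expGroup (L n) t x - x = ∫ s in (0 : ℝ)..t, expGroup (L n) s (L n x) :=
        fun n => by
          rw [intervalIntegral.integral_eq_sub_of_hasDerivAt
            (fun s _ => hasDerivAt_expGroup' (L n) x s)]
          · simp [expGroup_zero]
          · exact (continuous_iff_continuousAt.2 fun s =>
              (hasDerivAt_expGroup (L n) (L n x) s).continuousAt).intervalIntegrable _ _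
      obtain ⟨c, hc⟩ := (hl x hx).norm.bddAbove_range
      have h2 : Filter.Tendsto (fun n => ∫ s in (0 : ℝ)..t, expGroup (L n) s (L n x))
          Filter.atTop (𝓝 (∫ s in (0 : ℝ)..t, U s (l x))) := by
        refine intervalIntegral.tendsto_integral_filter_of_dominated_convergence (fun _ => c)
          (Filter.Eventually.of_forall fun n => ?_) (Filter.Eventually.of_forall fun n =>
            Filter.Eventually.of_forall fun s _ => ?_) intervalIntegrable_const
          (Filter.Eventually.of_forall fun s _ => hUm s (hl x hx))
        · exact (continuous_iff_continuousAt.2 fun s =>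
            (hasDerivAt_expGroup (L n) (L n x) s).continuousAt).aestronglyMeasurable
        · rw [norm_expGroup (hL n)]; exact hc ⟨n, rfl⟩
      simp only [← h1] at h2
      rw [← tendsto_nhds_unique ((hU t x).sub_const x) h2]; abel
    have := ((hcont (l x)).integral_hasStrictDerivAt 0 t).hasDerivAt.const_add x
    exact this.congr_of_eventuallyEq (Filter.Eventually.of_forall hint)

end Group

/-! ### Global solutions of Lipschitz ODEs -/

section GlobalODE

open Real BoundedContinuousFunction

variable {E : Type*} [NormedAddCommGroup E] [NormedSpace ℝ E]

theorem norm_exp_smul_integral_le {g : ℝ → E} {c r τ : ℝ} (hr : 0 < r) (hτ : 0 ≤ τ) (hc : 0 ≤ c)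
    (hg : ∀ s, 0 ≤ s → ‖g s‖ ≤ c * exp (r * s)) :
    ‖exp (-(r * τ)) • ∫ s in (0 : ℝ)..τ, g s‖ ≤ c / r := by
  have h1 : ‖∫ s in (0 : ℝ)..τ, g s‖ ≤ ∫ s in (0 : ℝ)..τ, c * exp (r * s) :=
    intervalIntegral.norm_integral_le_of_norm_le hτ
      (Filter.Eventually.of_forall fun s hs => hg s hs.1.le)
      ((by fun_prop : Continuous fun s => c * exp (r * s)).intervalIntegrable _ _)
  have h2 : ∫ s in (0 : ℝ)..τ, c * exp (r * s) = c / r * exp (r * τ) - c / r := by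
    have hd : ∀ s ∈ uIcc 0 τ, HasDerivAt (fun s => c / r * exp (r * s)) (c * exp (r * s)) s := by
      intro s _
      have := (((hasDerivAt_id s).const_mul r).exp).const_mul (c / r)
      refine this.congr_deriv ?_
      simp only [id]; field_simp
    rw [intervalIntegral.integral_eq_sub_of_hasDerivAt hd
      ((by fun_prop : Continuous fun s => c * exp (r * s)).intervalIntegrable _ _)]
    simp
  rw [norm_smul, Real.norm_of_nonneg (exp_pos _).le]
  calc exp (-(r * τ)) * ‖∫ s in (0 : ℝ)..τ, g s‖
      ≤ exp (-(r * τ)) * (c / r * exp (r * τ)) := by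
        gcongr
        rw [h2] at h1
        have : 0 ≤ c / r := by positivity
        linarith
    _ = c / r * (exp (-(r * τ)) * exp (r * τ)) := by ring
    _ = c / r := by rw [← exp_add]; simp

variable [CompleteSpace E]

/-- Picard iteration on the whole half-line at once: for ξ(t) = exp(-(K+1)t) z(t) the integral map
contracts by K/(K+1) in the sup norm. -/
theorem exists_global_solution {G : ℝ → E → E} (hG : Continuous (Function.uncurry G)) {K C : ℝ}
    (hK : 0 ≤ K) (hLip : ∀ t x y, ‖G t x - G t y‖ ≤ K * ‖x - y‖) (hC : ∀ t, ‖G t 0‖ ≤ C) (z₀ : E) :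
    ∃ z : ℝ → E, z 0 = z₀ ∧ ∀ t, 0 ≤ t → HasDerivAt z (G t (z t)) t := by
  set r := K + 1 with hr
  have hr0 : 0 < r := by positivity
  have hC0 : 0 ≤ C := (norm_nonneg _).trans (hC 0)
  have hgrow : ∀ t x, ‖G t x‖ ≤ C + K * ‖x‖ := fun t x => by
    have h1 := norm_add_le (G t x - G t 0) (G t 0)
    have h2 := hLip t x 0
    rw [sub_add_cancel] at h1
    rw [sub_zero] at h2
    linarith [hC t]
  have hcont : ∀ ξ : ℝ →ᵇ E, Continuous fun s => G s (exp (r * s) • ξ s) := fun ξ =>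
    hG.comp (continuous_id.prodMk ((by fun_prop : Continuous fun s => exp (r * s)).smul ξ.continuous))
  have hbd : ∀ (ξ : ℝ →ᵇ E) (s : ℝ), 0 ≤ s →
      ‖G s (exp (r * s) • ξ s)‖ ≤ (C + K * ‖ξ‖) * exp (r * s) := fun ξ s hs => by
    refine (hgrow _ _).trans ?_
    rw [norm_smul, Real.norm_of_nonneg (exp_pos _).le]
    have h1 : 1 ≤ exp (r * s) := one_le_exp (by positivity)
    have h2 := ξ.norm_coe_le_norm s
    have h3 : K * (exp (r * s) * ‖ξ s‖) ≤ K * (exp (r * s) * ‖ξ‖) := by gcongr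
    have h4 : C * 1 ≤ C * exp (r * s) := by gcongr
    linarith
  let Z : (ℝ →ᵇ E) → ℝ → E := fun ξ t => z₀ + ∫ s in (0 : ℝ)..t, G s (exp (r * s) • ξ s)
  have hZ : ∀ ξ t, HasDerivAt (Z ξ) (G t (exp (r * t) • ξ t)) t := fun ξ t =>
    ((hcont ξ).integral_hasStrictDerivAt 0 t).hasDerivAt.const_add z₀
  -- Freezing time at 0 for t < 0 allows bounded functions on ℝ to be used while only t ≥ 0 matters.
  have hmax : Continuous fun t : ℝ => max t 0 := by fun_prop
  let Φ : (ℝ →ᵇ E) → (ℝ →ᵇ E) := fun ξ =>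
    BoundedContinuousFunction.ofNormedAddCommGroup
      (fun t => exp (-(r * max t 0)) • Z ξ (max t 0))
      ((by fun_prop : Continuous fun t : ℝ => exp (-(r * max t 0))).smul
        ((continuous_iff_continuousAt.2 fun t => (hZ ξ t).continuousAt).comp hmax))
      (‖z₀‖ + (C + K * ‖ξ‖) / r) (fun t => by
        rw [smul_add]
        refine (norm_add_le _ _).trans (add_le_add ?_
          (norm_exp_smul_integral_le hr0 (le_max_right _ _) (by positivity) (hbd ξ)))
        rw [norm_smul, Real.norm_of_nonneg (exp_pos _).le]
        have : exp (-(r * max t 0)) ≤ 1 := by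
          rw [exp_le_one_iff, neg_nonpos]; have := le_max_right t 0; positivity
        nlinarith [norm_nonneg z₀])
  have hΦ : ∀ ξ t, Φ ξ t = exp (-(r * max t 0)) • Z ξ (max t 0) := fun ξ t => rfl
  have hKr : K / r < 1 := by rw [div_lt_one hr0]; linarith
  have hcontr : ContractingWith (K / r).toNNReal Φ := by
    refine ⟨by rw [Real.toNNReal_lt_one]; exact hKr, LipschitzWith.of_dist_le_mul fun ξ η => ?_⟩
    rw [Real.coe_toNNReal _ (by positivity)]
    refine (BoundedContinuousFunction.dist_le (by positivity)).2 fun t => ?_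
    rw [dist_eq_norm, hΦ, hΦ, ← smul_sub]
    have h1 : Z ξ (max t 0) - Z η (max t 0) = ∫ s in (0 : ℝ)..(max t 0),
        (G s (exp (r * s) • ξ s) - G s (exp (r * s) • η s)) := by
      rw [intervalIntegral.integral_sub ((hcont ξ).intervalIntegrable _ _)
        ((hcont η).intervalIntegrable _ _)]
      simp only [Z]; abel
    rw [h1, div_mul_eq_mul_div]
    refine norm_exp_smul_integral_le hr0 (le_max_right _ _) (by positivity) fun s hs => ?_
    refine (hLip _ _ _).trans ?_
    rw [← smul_sub, norm_smul, Real.norm_of_nonneg (exp_pos _).le, mul_assoc,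
      mul_comm (dist ξ η), ← dist_eq_norm]
    gcongr
    exact BoundedContinuousFunction.dist_coe_le_dist s
  obtain ⟨ξ, hξ, -⟩ := hcontr.exists_fixedPoint 0 (edist_ne_top _ _)
  refine ⟨Z ξ, by simp [Z], fun t ht => ?_⟩
  have h1 : exp (r * t) • ξ t = Z ξ t := by
    have h2 := hΦ ξ t
    rw [hξ, max_eq_left ht] at h2
    rw [h2, smul_smul, ← exp_add]; simp
  rw [← h1]
  exact hZ ξ t

end GlobalODE

/-! ### Differentiation and integration on [0, ∞) -/

section HalfLine

variable {E : Type*} [NormedAddCommGroup E]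

theorem continuous_comp_max {h : ℝ → E} (hh : ContinuousOn h (Ici 0)) :
    Continuous fun s => h (max s 0) :=
  hh.comp_continuous (by fun_prop) fun s => le_max_right s 0

variable [NormedSpace ℝ E]

theorem eq_of_hasDerivWithinAt_zero {a : ℝ → E}
    (ha : ∀ t, 0 ≤ t → HasDerivWithinAt a 0 (Ici 0) t) {t : ℝ} (ht : 0 ≤ t) : a t = a 0 := by
  have := (convex_Ici (0 : ℝ)).norm_image_sub_le_of_norm_hasDerivWithin_le (C := 0)
    (fun s hs => ha s hs) (fun s _ => by simp) (mem_Ici.2 le_rfl) (mem_Ici.2 ht)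
  rw [zero_mul] at this
  exact sub_eq_zero.1 (norm_le_zero_iff.1 this)

variable [CompleteSpace E]

theorem hasDerivWithinAt_of_eq_integral {a h : ℝ → E} (hh : ContinuousOn h (Ici 0))
    (ha : ∀ t, 0 ≤ t → a t = a 0 + ∫ s in (0 : ℝ)..t, h (max s 0)) {t : ℝ} (ht : 0 ≤ t) :
    HasDerivWithinAt a (h t) (Ici 0) t := by
  have h1 := (((continuous_comp_max hh).integral_hasStrictDerivAt 0 t).hasDerivAt.const_add
    (a 0)).hasDerivWithinAt (s := Ici 0)
  rw [max_eq_left ht] at h1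
  exact h1.congr (fun s hs => ha s hs) (ha t ht)

theorem eq_integral_of_hasDerivWithinAt {a h : ℝ → E} (hh : ContinuousOn h (Ici 0))
    (ha : ∀ t, 0 ≤ t → HasDerivWithinAt a (h t) (Ici 0) t) {t : ℝ} (ht : 0 ≤ t) :
    a t = a 0 + ∫ s in (0 : ℝ)..t, h (max s 0) := by
  have h1 : ∀ s, 0 ≤ s →
      HasDerivWithinAt (fun s => a s - ∫ r in (0 : ℝ)..s, h (max r 0)) 0 (Ici 0) s := by
    intro s hs
    have h2 := ((continuous_comp_max hh).integral_hasStrictDerivAt 0 s).hasDerivAt.hasDerivWithinAt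
      (s := Ici 0)
    rw [max_eq_left hs] at h2
    exact ((ha s hs).sub h2).congr_deriv (sub_self _)
  have h3 := eq_of_hasDerivWithinAt_zero h1 ht
  simp only [intervalIntegral.integral_same, sub_zero] at h3
  rw [← h3]; abel

/-- A continuous weak derivative is a strong one: each scalar component equals that of the integral
of h. -/
theorem hasDerivWithinAt_of_inner {H : Type*} [NormedAddCommGroup H] [InnerProductSpace ℝ H]
    [CompleteSpace H] {a h : ℝ → H} (hh : ContinuousOn h (Ici 0))
    (ha : ∀ φ : H, ∀ t, 0 ≤ t → HasDerivWithinAt (fun s => ⟪a s, φ⟫) ⟪h t, φ⟫ (Ici 0) t)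
    {t : ℝ} (ht : 0 ≤ t) : HasDerivWithinAt a (h t) (Ici 0) t := by
  refine hasDerivWithinAt_of_eq_integral hh (fun t ht => ?_) ht
  refine ext_inner_right ℝ fun φ => ?_
  have h1 : ∀ s, 0 ≤ s → HasDerivWithinAt
      (fun s => ⟪a s, φ⟫ - ⟪∫ r in (0 : ℝ)..s, h (max r 0), φ⟫) 0 (Ici 0) s := by
    intro s hs
    have h2 := ((continuous_comp_max hh).integral_hasStrictDerivAt 0 s).hasDerivAt.hasDerivWithinAt
      (s := Ici 0)
    rw [max_eq_left hs] at h2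
    have h3 := h2.inner ℝ (hasDerivWithinAt_const s (Ici 0) φ)
    rw [inner_zero_right, zero_add] at h3
    exact ((ha φ s hs).sub h3).congr_deriv (sub_self _)
  have h3 := eq_of_hasDerivWithinAt_zero h1 ht
  simp only [intervalIntegral.integral_same, inner_zero_left, sub_zero] at h3
  rw [inner_add_left, ← h3]; ring

end HalfLine

/-! ### Energy identity for the weak linear wave equation -/

section WeakWave

variable {H : Type*} [NormedAddCommGroup H] [InnerProductSpace ℝ H]

/-- `u` is a weak solution of `u'' + B² u = g` on `[0, ∞)`, with `w = B u` and `v = u'`. -/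
structure IsWeakWave (B : H →ₗ.[ℝ] H) (u w v g : ℝ → H) : Prop where
  continuousOn_w : ContinuousOn w (Ici 0)
  continuousOn_v : ContinuousOn v (Ici 0)
  continuousOn_g : ContinuousOn g (Ici 0)
  mem_graph : ∀ t, 0 ≤ t → (u t, w t) ∈ B.graph
  hasDeriv_u : ∀ t, 0 ≤ t → HasDerivWithinAt u (v t) (Ici 0) t
  hasDeriv_v : ∀ φ φ' : H, (φ, φ') ∈ B.graph → ∀ t, 0 ≤ t →
    HasDerivWithinAt (fun s => ⟪v s, φ⟫) (-⟪w t, φ'⟫ + ⟪g t, φ⟫) (Ici 0) t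

namespace IsWeakWave

variable {B : H →ₗ.[ℝ] H} {u w v g : ℝ → H}

theorem continuousOn_u (h : IsWeakWave B u w v g) : ContinuousOn u (Ici 0) :=
  fun t ht => (h.hasDeriv_u t ht).continuousWithinAt

theorem sub {u₂ w₂ v₂ g₂ : ℝ → H} (h : IsWeakWave B u w v g) (h₂ : IsWeakWave B u₂ w₂ v₂ g₂) :
    IsWeakWave B (fun t => u t - u₂ t) (fun t => w t - w₂ t) (fun t => v t - v₂ t)
      (fun t => g t - g₂ t) where
  continuousOn_w := h.continuousOn_w.sub h₂.continuousOn_w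
  continuousOn_v := h.continuousOn_v.sub h₂.continuousOn_v
  continuousOn_g := h.continuousOn_g.sub h₂.continuousOn_g
  mem_graph t ht := graph_sub (h.mem_graph t ht) (h₂.mem_graph t ht)
  hasDeriv_u t ht := (h.hasDeriv_u t ht).sub (h₂.hasDeriv_u t ht)
  hasDeriv_v φ φ' hφ t ht := by
    have := (h.hasDeriv_v φ φ' hφ t ht).sub (h₂.hasDeriv_v φ φ' hφ t ht)
    simp only [inner_sub_left]
    exact this.congr_deriv (by ring)

/-- Product rule for `⟨x, u'⟩` with `x` differentiable in `H` and `x(t) ∈ D(B)`. -/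
theorem hasDeriv_inner (h : IsWeakWave B u w v g) {x : ℝ → H} {x' y : H} {t : ℝ} (ht : 0 ≤ t)
    (hx : HasDerivWithinAt x x' (Ici 0) t) (hxy : (x t, y) ∈ B.graph) :
    HasDerivWithinAt (fun s => ⟪x s, v s⟫) (⟪x', v t⟫ + (-⟪w t, y⟫ + ⟪g t, x t⟫)) (Ici 0) t := by
  -- v has no derivative in H. After splitting off the fixed test vector x t, the remaining factor
  -- vanishes at t, so continuity of v suffices.
  have h1 : HasDerivWithinAt (fun s => ⟪x s - x t, v s⟫) ⟪x', v t⟫ (Ici 0) t := by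
    rw [hasDerivWithinAt_iff_tendsto_slope] at hx ⊢
    have h2 : Filter.Tendsto v (𝓝[Ici 0 \ {t}] t) (𝓝 (v t)) :=
      (h.continuousOn_v t ht).mono_left (nhdsWithin_mono _ sdiff_subset)
    refine (hx.inner (𝕜 := ℝ) h2).congr fun s => ?_
    simp only [slope_def_module, sub_self, inner_zero_left, sub_zero, real_inner_smul_left,
      smul_eq_mul]
  have h3 := h1.add (h.hasDeriv_v _ _ hxy t ht)
  refine h3.congr (fun s _ => ?_) ?_ <;>
  · simp only [Pi.add_apply]
    rw [inner_sub_left, real_inner_comm (x t)]; ring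

variable [CompleteSpace H]

/-- J n v and J n w are strongly differentiable and their coupling terms cancel by symmetry. The
integrated identity then passes to the limit, dominated through ‖J n x‖ ≤ 2‖x‖. -/
theorem hasDeriv_energy (hB : IsSelfAdjoint B) (h : IsWeakWave B u w v g) {t : ℝ} (ht : 0 ≤ t) :
    HasDerivWithinAt (fun s => ‖v s‖ ^ 2 + ‖w s‖ ^ 2) (2 * ⟪g t, v t⟫) (Ici 0) t := by
  obtain ⟨J, C, hJC⟩ := exists_isRegularization hB
  have hcv : ∀ T : H →L[ℝ] H, ContinuousOn (fun s => T (v s)) (Ici 0) :=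
    fun T => T.continuous.comp_continuousOn h.continuousOn_v
  have hcw : ∀ T : H →L[ℝ] H, ContinuousOn (fun s => T (w s)) (Ici 0) :=
    fun T => T.continuous.comp_continuousOn h.continuousOn_w
  have hcg : ∀ T : H →L[ℝ] H, ContinuousOn (fun s => T (g s)) (Ici 0) :=
    fun T => T.continuous.comp_continuousOn h.continuousOn_g
  have hv : ∀ n s, 0 ≤ s →
      HasDerivWithinAt (fun s => J n (v s)) (-C n (w s) + J n (g s)) (Ici 0) s := fun n s hs => by
    refine hasDerivWithinAt_of_inner ((hcw (C n)).neg.add (hcg (J n))) (fun φ t ht => ?_) hs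
    have := h.hasDeriv_v _ _ (hJC.mem_graph n φ) t ht
    simp only [hJC.inner_J]
    refine this.congr_deriv ?_
    change _ = ⟪-C n (w t) + J n (g t), φ⟫
    rw [inner_add_left, inner_neg_left, hJC.inner_C, hJC.inner_J]
  have hw : ∀ n s, 0 ≤ s → HasDerivWithinAt (fun s => J n (w s)) (C n (v s)) (Ici 0) s := by
    intro n s hs
    have h1 : ∀ s, 0 ≤ s → J n (w s) = C n (u s) :=
      fun s hs => (hJC.C_apply _ _ _ (h.mem_graph s hs)).symm
    refine HasDerivWithinAt.congr ?_ (fun s hs => h1 s hs) (h1 s hs)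
    exact (C n).hasFDerivAt.comp_hasDerivWithinAt s (h.hasDeriv_u s hs)
  have he : ∀ n s, 0 ≤ s → HasDerivWithinAt (fun s => ‖J n (v s)‖ ^ 2 + ‖J n (w s)‖ ^ 2)
      (2 * ⟪J n (g s), J n (v s)⟫) (Ici 0) s := fun n s hs => by
    refine ((hv n s hs).norm_sq.add (hw n s hs).norm_sq).congr_deriv ?_
    have h1 : ⟪J n (w s), C n (v s)⟫ = ⟪J n (v s), C n (w s)⟫ := by
      rw [real_inner_comm, hJC.inner_C, ← hJC.commute_J, ← hJC.inner_J]
    rw [inner_add_right, inner_neg_right, h1, real_inner_comm (J n (g s))]; ring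
  have hint : ∀ n s, 0 ≤ s → ‖J n (v s)‖ ^ 2 + ‖J n (w s)‖ ^ 2 =
      (‖J n (v 0)‖ ^ 2 + ‖J n (w 0)‖ ^ 2) +
        ∫ r in (0 : ℝ)..s, 2 * ⟪J n (g (max r 0)), J n (v (max r 0))⟫ := fun n s hs =>
    eq_integral_of_hasDerivWithinAt
      (continuousOn_const.mul ((hcg (J n)).inner (hcv (J n)))) (he n) hs
  have hcont : ContinuousOn (fun s => 2 * ⟪g s, v s⟫) (Ici 0) :=
    continuousOn_const.mul (h.continuousOn_g.inner h.continuousOn_v)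
  refine hasDerivWithinAt_of_eq_integral hcont (fun s hs => ?_) ht
  have hlim : ∀ x, Filter.Tendsto (fun n => ‖J n x‖ ^ 2) Filter.atTop (𝓝 (‖x‖ ^ 2)) :=
    fun x => (hJC.tendsto_J x).norm.pow 2
  have hR : Filter.Tendsto (fun n => ∫ r in (0 : ℝ)..s, 2 * ⟪J n (g (max r 0)), J n (v (max r 0))⟫)
      Filter.atTop (𝓝 (∫ r in (0 : ℝ)..s, 2 * ⟪g (max r 0), v (max r 0)⟫)) := by
    refine intervalIntegral.tendsto_integral_filter_of_dominated_convergence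
      (fun r => 8 * (‖g (max r 0)‖ * ‖v (max r 0)‖))
      (Filter.Eventually.of_forall fun n => ?_) (Filter.Eventually.of_forall fun n =>
        Filter.Eventually.of_forall fun r _ => ?_) ?_
      (Filter.Eventually.of_forall fun r _ =>
        ((hJC.tendsto_J _).inner (hJC.tendsto_J _)).const_mul 2)
    · exact (continuous_comp_max (h := fun s => 2 * ⟪J n (g s), J n (v s)⟫)
        (continuousOn_const.mul ((hcg (J n)).inner (hcv (J n))))).aestronglyMeasurable
    · have h1 := abs_real_inner_le_norm (J n (g (max r 0))) (J n (v (max r 0)))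
      have h2 := mul_le_mul (hJC.norm_J_le n (g (max r 0))) (hJC.norm_J_le n (v (max r 0)))
        (norm_nonneg _) (by positivity)
      rw [Real.norm_eq_abs, abs_mul, abs_two]
      linarith
    · exact (continuous_comp_max (h := fun s => 8 * (‖g s‖ * ‖v s‖))
        (continuousOn_const.mul (h.continuousOn_g.norm.mul
          h.continuousOn_v.norm))).intervalIntegrable _ _
  refine tendsto_nhds_unique ((hlim (v s)).add (hlim (w s))) ?_
  simp only [hint _ s hs]
  exact ((hlim (v 0)).add (hlim (w 0))).add hR

end IsWeakWave

end WeakWave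

/-! ### Existence for Lipschitz nonlinearities -/

section Existence

variable {H : Type*} [NormedAddCommGroup H] [InnerProductSpace ℝ H]

/-- The bounded operator `(a, b) ↦ (C b, -C a)` on `H ⊕ H`. -/
def skewBlock (C : H →L[ℝ] H) : WithLp 2 (H × H) →L[ℝ] WithLp 2 (H × H) :=
  ((WithLp.prodContinuousLinearEquiv 2 ℝ H H).symm : H × H →L[ℝ] WithLp 2 (H × H)) ∘L
    ((C ∘L WithLp.sndL 2 ℝ H H).prod (-(C ∘L WithLp.fstL 2 ℝ H H)))

theorem skewBlock_apply (C : H →L[ℝ] H) (x : WithLp 2 (H × H)) :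
    skewBlock C x = WithLp.toLp 2 (C x.snd, -C x.fst) := rfl

variable [CompleteSpace H]

/-- The pair (w, v) = (Bu, u') obeys w' = Bv, v' = -Bw in the linear case, a skew system
approximated by `skewBlock (C n)`. -/
theorem exists_wave_group {B : H →ₗ.[ℝ] H} (hB : IsSelfAdjoint B) :
    ∃ U : ℝ → WithLp 2 (H × H) →L[ℝ] WithLp 2 (H × H), (∀ x, U 0 x = x) ∧
      (∀ t x, ‖U t x‖ = ‖x‖) ∧ (∀ t x, U t (U (-t) x) = x) ∧
      (∀ t x y, ⟪U t x, y⟫ = ⟪x, U (-t) y⟫) ∧ (∀ x, Continuous fun t => U t x) ∧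
      ∀ a a' b b', (a, a') ∈ B.graph → (b, b') ∈ B.graph → ∀ t,
        HasDerivAt (fun s => U s (WithLp.toLp 2 (a, b))) (U t (WithLp.toLp 2 (b', -a'))) t := by
  classical
  obtain ⟨J, C, hJC⟩ := exists_isRegularization hB
  let ext : H → H := fun x => if h : x ∈ B.domain then B ⟨x, h⟩ else 0
  have hext : ∀ {x y}, (x, y) ∈ B.graph → ext x = y := fun {x y} h => by
    obtain ⟨x, rfl, rfl⟩ := (LinearPMap.mem_graph_iff _).1 h
    simp only [ext]
    exact dif_pos x.2
  have hextg : ∀ {x}, x ∈ B.domain → (x, ext x) ∈ B.graph := fun {x} h => by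
    have h1 := B.mem_graph ⟨x, h⟩
    rwa [← hext h1] at h1
  let D : Set (WithLp 2 (H × H)) :=
    WithLp.prodContinuousLinearEquiv 2 ℝ H H ⁻¹' ((B.domain : Set H) ×ˢ (B.domain : Set H))
  have hD : Dense D := (hB.dense_domain.prod hB.dense_domain).preimage
    (WithLp.prodContinuousLinearEquiv 2 ℝ H H).toHomeomorph.isOpenMap
  have hClim : ∀ {x y}, (x, y) ∈ B.graph →
      Filter.Tendsto (fun n => C n x) Filter.atTop (𝓝 y) := fun {x y} h => by
    simp only [hJC.C_apply _ _ _ h]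
    exact hJC.tendsto_J y
  have hskew : ∀ n x y, ⟪skewBlock (C n) x, y⟫ = -⟪x, skewBlock (C n) y⟫ := fun n x y => by
    rw [WithLp.prod_inner_apply, WithLp.prod_inner_apply]
    change ⟪C n x.snd, y.fst⟫ + ⟪-C n x.fst, y.snd⟫ = -(⟪x.fst, C n y.snd⟫ + ⟪x.snd, -C n y.fst⟫)
    rw [inner_neg_left, inner_neg_right, hJC.inner_C, hJC.inner_C]; ring
  have hcomm : ∀ m n, Commute (skewBlock (C m)) (skewBlock (C n)) := fun m n => by
    have hc : ∀ x, C m (C n x) = C n (C m x) := fun x =>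
      congrArg (fun T : H →L[ℝ] H => T x) (hJC.commute_C m n).eq
    refine ContinuousLinearMap.ext fun x => ?_
    change skewBlock (C m) (skewBlock (C n) x) = skewBlock (C n) (skewBlock (C m) x)
    simp only [skewBlock_apply, WithLp.toLp_fst, WithLp.toLp_snd, map_neg, hc]
  have hlim : ∀ x ∈ D, Filter.Tendsto (fun n => skewBlock (C n) x) Filter.atTop
      (𝓝 (WithLp.toLp 2 (ext x.snd, -ext x.fst))) := fun x hx =>
    ((WithLp.prodContinuousLinearEquiv 2 ℝ H H).symm.continuous.tendsto _).comp
      ((hClim (hextg hx.2)).prodMk_nhds (hClim (hextg hx.1)).neg)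
  obtain ⟨U, h0, h1, h2, h3, h4, h5⟩ := exists_group hskew hcomm hD hlim
  refine ⟨U, h0, h1, h2, h3, h4, fun a a' b b' ha hb t => ?_⟩
  have ha' : a ∈ B.domain := LinearPMap.mem_domain_of_mem_graph ha
  have hb' : b ∈ B.domain := LinearPMap.mem_domain_of_mem_graph hb
  have := h5 (WithLp.toLp 2 (a, b)) ⟨ha', hb'⟩ t
  simp only [WithLp.toLp_fst, WithLp.toLp_snd, hext ha, hext hb] at this
  exact this

/-- Variation of constants: with (w, v) = U(t)y, the unknown (u, y) solves u' = v, y' = U(-t)(0, -v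
- f(u)). This field is Lipschitz and contains no unbounded operator. -/
theorem exists_isWeakWave_of_lipschitz {B : H →ₗ.[ℝ] H} (hB : IsSelfAdjoint B) {f : H → H} {K : ℝ}
    (hK : 0 ≤ K) (hf : ∀ x y, ‖f x - f y‖ ≤ K * ‖x - y‖) {u₀ w₀ : H} (h₀ : (u₀, w₀) ∈ B.graph)
    (v₀ : H) :
    ∃ u w v : ℝ → H, IsWeakWave B u w v (fun t => -v t - f (u t)) ∧ u 0 = u₀ ∧ v 0 = v₀ := by
  obtain ⟨U, hU0, hUn, hUi, hUa, hUc, hUd⟩ := exists_wave_group hB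
  have hUsub : ∀ t x y, ‖U t x - U t y‖ = ‖x - y‖ := fun t x y => by rw [← map_sub, hUn]
  have hUcont : Continuous fun q : ℝ × WithLp 2 (H × H) => U q.1 q.2 := by
    refine continuous_prod_of_continuous_lipschitzWith' _ 1 (fun t => ?_) (fun x => hUc x)
    exact LipschitzWith.of_dist_le_mul fun x y => by
      rw [dist_eq_norm, dist_eq_norm, hUsub]; simp
  have hfc : Continuous f :=
    (LipschitzWith.of_dist_le_mul (K := K.toNNReal) fun x y => by
      rw [dist_eq_norm, dist_eq_norm, Real.coe_toNNReal _ hK]; exact hf x y).continuous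
  let snd : WithLp 2 (H × H) →L[ℝ] H := WithLp.sndL 2 ℝ H H
  let fst : WithLp 2 (H × H) →L[ℝ] H := WithLp.fstL 2 ℝ H H
  let inr : H →L[ℝ] WithLp 2 (H × H) :=
    ((WithLp.prodContinuousLinearEquiv 2 ℝ H H).symm : H × H →L[ℝ] WithLp 2 (H × H)) ∘L
      ContinuousLinearMap.inr ℝ H H
  have hinr : ∀ x, ‖inr x‖ = ‖x‖ := fun x => WithLp.norm_toLp_snd 2 H H x
  have hsnd : ∀ x, ‖snd x‖ ≤ ‖x‖ := fun x => WithLp.norm_snd_le H x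
  let N : ℝ → H × WithLp 2 (H × H) → H := fun t z => -snd (U t z.2) - f z.1
  let G : ℝ → H × WithLp 2 (H × H) → H × WithLp 2 (H × H) := fun t z =>
    (snd (U t z.2), U (-t) (inr (N t z)))
  have hUc2 : Continuous fun q : ℝ × (H × WithLp 2 (H × H)) => U q.1 q.2.2 :=
    hUcont.comp (continuous_fst.prodMk (continuous_snd.comp continuous_snd))
  have hG : Continuous (Function.uncurry G) := by
    refine (snd.continuous.comp hUc2).prodMk
      (hUcont.comp (continuous_fst.neg.prodMk (inr.continuous.comp ?_)))
    exact (snd.continuous.comp hUc2).neg.sub (hfc.comp (continuous_fst.comp continuous_snd))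
  have hGl : ∀ t x y, ‖G t x - G t y‖ ≤ (1 + K) * ‖x - y‖ := fun t x y => by
    have e1 : ‖snd (U t x.2) - snd (U t y.2)‖ ≤ ‖x.2 - y.2‖ := by
      rw [← map_sub, ← hUsub t]; exact hsnd _
    have e2 := hf x.1 y.1
    have e3 : ‖x.1 - y.1‖ ≤ ‖x - y‖ := norm_fst_le (x - y)
    have e4 : ‖x.2 - y.2‖ ≤ ‖x - y‖ := norm_snd_le (x - y)
    have e5 : K * ‖x.1 - y.1‖ ≤ K * ‖x - y‖ := by gcongr
    refine max_le ?_ ?_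
    · change ‖snd (U t x.2) - snd (U t y.2)‖ ≤ _
      nlinarith [norm_nonneg (x - y)]
    · change ‖U (-t) (inr (N t x)) - U (-t) (inr (N t y))‖ ≤ _
      rw [hUsub, ← map_sub, hinr]
      have e6 : N t x - N t y = -(snd (U t x.2) - snd (U t y.2)) - (f x.1 - f y.1) := by
        simp only [N]; abel
      rw [e6]
      refine (norm_sub_le _ _).trans ?_
      rw [norm_neg]
      linarith
  have hG0 : ∀ t, ‖G t 0‖ ≤ ‖f 0‖ := fun t => by
    have e1 : G t 0 = (0, U (-t) (inr (-f 0))) := by simp [G, N]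
    rw [e1]
    refine max_le (by simp) ?_
    change ‖U (-t) (inr (-f 0))‖ ≤ _
    rw [hUn, hinr, norm_neg]
  obtain ⟨z, hz0, hz⟩ := exists_global_solution hG (by positivity) hGl hG0
    (u₀, WithLp.toLp 2 (w₀, v₀))
  let x : ℝ → WithLp 2 (H × H) := fun t => U t (z t).2
  have hzc : ContinuousOn z (Ici 0) := fun t ht => (hz t ht).continuousAt.continuousWithinAt
  have hxc : ContinuousOn x (Ici 0) :=
    hUcont.comp_continuousOn (continuousOn_id.prodMk (continuous_snd.comp_continuousOn hzc))
  have hx0 : x 0 = WithLp.toLp 2 (w₀, v₀) := by simp only [x, hU0, hz0]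
  have hu' : ∀ t, 0 ≤ t → HasDerivAt (fun t => (z t).1) (snd (x t)) t := fun t ht => (hz t ht).fst
  have hy' : ∀ t, 0 ≤ t → HasDerivAt (fun t => (z t).2) (U (-t) (inr (N t (z t)))) t :=
    fun t ht => (hz t ht).snd
  have key : ∀ a a' b b', (a, a') ∈ B.graph → (b, b') ∈ B.graph → ∀ t, 0 ≤ t →
      HasDerivAt (fun s => ⟪fst (x s), a⟫ + ⟪snd (x s), b⟫)
        (⟪N t (z t), b⟫ - ⟪fst (x t), b'⟫ + ⟪snd (x t), a'⟫) t := by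
    intro a a' b b' ha hb t ht
    have e1 : HasDerivAt (fun s => U (-s) (WithLp.toLp 2 (a, b)))
        (-(U (-t) (WithLp.toLp 2 (b', -a')))) t := by
      exact ((hUd a a' b b' ha hb (-t)).scomp t (hasDerivAt_neg t)).congr_deriv (neg_one_smul ℝ _)
    have e2 := (hy' t ht).inner ℝ e1
    have e3 : ∀ s, ⟪(z s).2, U (-s) (WithLp.toLp 2 (a, b))⟫ = ⟪fst (x s), a⟫ + ⟪snd (x s), b⟫ :=
      fun s => by rw [← hUa, WithLp.prod_inner_apply]; rfl
    simp only [e3] at e2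
    refine e2.congr_deriv ?_
    rw [inner_neg_right, ← hUa, ← hUa, hUi, WithLp.prod_inner_apply, WithLp.prod_inner_apply]
    change -(⟪fst (x t), b'⟫ + ⟪snd (x t), -a'⟫) + (⟪(0 : H), a⟫ + ⟪N t (z t), b⟫) = _
    rw [inner_neg_right, inner_zero_left]; ring
  have hg0 : ((0 : H), (0 : H)) ∈ B.graph := B.graph.zero_mem
  refine ⟨fun t => (z t).1, fun t => fst (x t), fun t => snd (x t), ⟨?_, ?_, ?_, ?_, ?_, ?_⟩,
    by simp only [hz0], by simp only [hx0]; rfl⟩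
  · exact fst.continuous.comp_continuousOn hxc
  · exact snd.continuous.comp_continuousOn hxc
  · exact (snd.continuous.comp_continuousOn hxc).neg.sub
      (hfc.comp_continuousOn (continuous_fst.comp_continuousOn hzc))
  · intro t ht
    refine (mem_graph_iff_of_isSelfAdjoint hB).2 fun a => ?_
    -- The relation w = Bu is not built into the ODE. It is propagated from t = 0, since ⟨w, a⟩ -
    -- ⟨u, Ba⟩ is constant for every a in D(B).
    have e1 : ∀ s, 0 ≤ s →
        HasDerivWithinAt (fun s => ⟪fst (x s), (a : H)⟫ - ⟪(z s).1, B a⟫) 0 (Ici 0) s := by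
      intro s hs
      have e2 := key _ _ 0 0 (B.mem_graph a) hg0 s hs
      have e3 := (hu' s hs).inner ℝ (hasDerivAt_const s (B a))
      simp only [inner_zero_right, add_zero, sub_zero, zero_add] at e2 e3
      exact ((e2.sub e3).congr_deriv (sub_self _)).hasDerivWithinAt
    have e4 := eq_of_hasDerivWithinAt_zero e1 ht
    have e5 : ⟪w₀, (a : H)⟫ = ⟪u₀, B a⟫ := inner_graph_of_isSelfAdjoint hB h₀ (B.mem_graph a)
    simp only [hz0, hx0] at e4
    change _ = ⟪w₀, (a : H)⟫ - ⟪u₀, B a⟫ at e4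
    rw [e5, sub_self, sub_eq_zero] at e4
    rw [real_inner_comm, ← e4, real_inner_comm]
  · exact fun t ht => (hu' t ht).hasDerivWithinAt
  · intro φ φ' hφ t ht
    have e1 := key 0 0 φ φ' hg0 hφ t ht
    simp only [inner_zero_right, add_zero, zero_add] at e1
    exact (e1.congr_deriv (sub_eq_neg_add _ _)).hasDerivWithinAt

end Existence

/-! ### Monotonicity and first-time arguments -/

section HalfLineComparison

theorem le_of_hasDerivWithinAt_nonpos {a a' : ℝ → ℝ} {s t : ℝ} (hs : 0 ≤ s) (hst : s ≤ t)
    (ha : ∀ r, 0 ≤ r → HasDerivWithinAt a (a' r) (Ici 0) r)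
    (h : ∀ r, s < r → r < t → a' r ≤ 0) : a t ≤ a s := by
  have h1 : AntitoneOn a (Icc s t) := by
    refine antitoneOn_of_hasDerivWithinAt_nonpos (f' := a') (convex_Icc s t)
      (fun r hr => (ha r (hs.trans hr.1)).continuousWithinAt.mono fun x hx => hs.trans hx.1)
      (fun r hr => ?_) (fun r hr => ?_) <;> rw [interior_Icc] at *
    · exact (ha r (hs.trans hr.1.le)).mono fun x hx => hs.trans hx.1.le
    · exact h r hr.1 hr.2
  exact h1 ⟨le_rfl, hst⟩ ⟨hst, le_rfl⟩ hst

theorem exists_first_nonpos {D : ℝ → ℝ} (hD : ContinuousOn D (Ici 0)) {t : ℝ}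
    (ht : 0 ≤ t) (htD : D t ≤ 0) : ∃ T, 0 ≤ T ∧ D T ≤ 0 ∧ ∀ s, 0 ≤ s → s < T → 0 < D s := by
  set Z : Set ℝ := Ici 0 ∩ D ⁻¹' Iic 0
  have hcl : IsClosed Z := hD.preimage_isClosed_of_isClosed isClosed_Ici isClosed_Iic
  have hbd : BddBelow Z := ⟨0, fun s hs => hs.1⟩
  have hmem := hcl.csInf_mem ⟨t, ht, htD⟩ hbd
  refine ⟨sInf Z, hmem.1, hmem.2, fun s hs hsT => ?_⟩
  by_contra! h
  exact absurd (csInf_le hbd (⟨hs, h⟩ : s ∈ Z)) (not_le.2 hsT)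

end HalfLineComparison

/-! ### Lipschitz estimates for the power nonlinearity -/

section PowerNonlinearity

variable {H : Type*} [NormedAddCommGroup H] [InnerProductSpace ℝ H]

/-- The graph of s ↦ s^{p+1} lies above its tangent at y (Bernoulli). Multiplying by x keeps the
bound valid near 0 even when p < 1. -/
theorem mul_rpow_sub_rpow_le {p x y : ℝ} (hp : 0 < p) (hx : 0 ≤ x) (hxy : x ≤ y) :
    x * (y ^ p - x ^ p) ≤ (p + 1) * y ^ p * (y - x) := by
  rcases hx.eq_or_lt with rfl | hx
  · rw [zero_mul, sub_zero]; positivity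
  have hy : 0 < y := hx.trans_le hxy
  have h1 := one_add_mul_self_le_rpow_one_add (s := x / y - 1) (p := p + 1)
    (by linarith [div_nonneg hx.le hy.le]) (by linarith)
  rw [add_sub_cancel, Real.div_rpow hx.le hy.le, Real.rpow_add hx, Real.rpow_add hy,
    Real.rpow_one, Real.rpow_one, le_div_iff₀ (by positivity)] at h1
  have h2 : (1 + (p + 1) * (x / y - 1)) * (y ^ p * y) = y ^ p * (y + (p + 1) * (x - y)) := by
    field_simp
  rw [h2] at h1
  have h3 : x * y ^ p ≤ y * y ^ p := by gcongr
  nlinarith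

theorem norm_min_rpow_smul_sub_le {p R : ℝ} (hp : 0 < p) (hR : 0 ≤ R) (a b : H) :
    ‖(min ‖a‖ R) ^ p • a - (min ‖b‖ R) ^ p • b‖ ≤ (p + 2) * R ^ p * ‖a - b‖ := by
  wlog hab : ‖a‖ ≤ ‖b‖ generalizing a b with h
  · rw [norm_sub_rev, norm_sub_rev a]
    exact h b a (le_of_not_ge hab)
  have ha0 : 0 ≤ min ‖a‖ R := le_min (norm_nonneg _) hR
  have hb0 : 0 ≤ min ‖b‖ R := le_min (norm_nonneg _) hR
  have hmin : min ‖a‖ R ≤ min ‖b‖ R := min_le_min_right _ hab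
  have hbR : (min ‖b‖ R) ^ p ≤ R ^ p := by gcongr; exact min_le_right _ _
  have hmono : (min ‖a‖ R) ^ p ≤ (min ‖b‖ R) ^ p := by gcongr
  have h1 : (min ‖a‖ R) ^ p • a - (min ‖b‖ R) ^ p • b =
      (min ‖b‖ R) ^ p • (a - b) - ((min ‖b‖ R) ^ p - (min ‖a‖ R) ^ p) • a := by
    rw [smul_sub, sub_smul]; abel
  have h2 : ((min ‖b‖ R) ^ p - (min ‖a‖ R) ^ p) * ‖a‖ ≤ (p + 1) * R ^ p * ‖a - b‖ := by
    rcases le_total R ‖a‖ with hRa | hRa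
    · rw [min_eq_right hRa, min_eq_right (hRa.trans hab), sub_self, zero_mul]
      positivity
    · rw [min_eq_left hRa] at hmin hmono ⊢
      have h3 := mul_rpow_sub_rpow_le hp (norm_nonneg a) hmin
      have h4 : min ‖b‖ R - ‖a‖ ≤ ‖a - b‖ := by
        have := norm_sub_norm_le b a
        rw [norm_sub_rev] at this
        linarith [min_le_left ‖b‖ R]
      calc ((min ‖b‖ R) ^ p - ‖a‖ ^ p) * ‖a‖
          = ‖a‖ * ((min ‖b‖ R) ^ p - ‖a‖ ^ p) := mul_comm _ _
        _ ≤ (p + 1) * (min ‖b‖ R) ^ p * (min ‖b‖ R - ‖a‖) := h3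
        _ ≤ (p + 1) * R ^ p * ‖a - b‖ := by
          have : 0 ≤ min ‖b‖ R - ‖a‖ := sub_nonneg.2 hmin
          gcongr
  rw [h1]
  refine (norm_sub_le _ _).trans ?_
  rw [norm_smul, norm_smul, Real.norm_of_nonneg (by positivity),
    Real.norm_of_nonneg (sub_nonneg.2 hmono)]
  have h5 : (min ‖b‖ R) ^ p * ‖a - b‖ ≤ R ^ p * ‖a - b‖ := by gcongr
  linarith

theorem norm_rpow_smul_sub_le {p R : ℝ} (hp : 0 < p) {a b : H} (ha : ‖a‖ ≤ R) (hb : ‖b‖ ≤ R) :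
    ‖‖a‖ ^ p • a - ‖b‖ ^ p • b‖ ≤ (p + 2) * R ^ p * ‖a - b‖ := by
  have := norm_min_rpow_smul_sub_le hp ((norm_nonneg _).trans ha) a b
  rwa [min_eq_left ha, min_eq_left hb] at this

theorem hasDerivWithinAt_norm_rpow {x : ℝ → H} {x' : H} {s : Set ℝ} {t q : ℝ} (hq : 1 < q)
    (hx : HasDerivWithinAt x x' s t) :
    HasDerivWithinAt (fun s => ‖x s‖ ^ q) (q * ‖x t‖ ^ (q - 2) * ⟪x t, x'⟫) s t := by
  have := (hasFDerivAt_norm_rpow (x t) hq).comp_hasDerivWithinAt t hx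
  exact this.congr_deriv (by simp)

theorem continuous_norm_rpow_smul {p : ℝ} (hp : 0 < p) : Continuous fun x : H => ‖x‖ ^ p • x :=
  (continuous_norm.rpow_const fun _ => Or.inr hp.le).smul continuous_id

end PowerNonlinearity

/-! ### Well-posedness of the damped nonlinear equation -/

section NonlinearWave

variable {H : Type*} [NormedAddCommGroup H] [InnerProductSpace ℝ H]

/-- `u` is a weak solution of `u'' + u' + B² u + |P u|^p P u = 0`, with `w = B u` and `v = u'`. -/
def IsDampedWave (B : H →ₗ.[ℝ] H) (P : H →L[ℝ] H) (p : ℝ) (u w v : ℝ → H) : Prop :=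
  IsWeakWave B u w v (fun t => -v t - ‖P (u t)‖ ^ p • P (u t))

/-- The total energy. -/
def energy (P : H →L[ℝ] H) (p : ℝ) (u w v : H) : ℝ :=
  (‖v‖ ^ 2 + ‖w‖ ^ 2) / 2 + ‖P u‖ ^ (p + 2) / (p + 2)

theorem energy_nonneg (P : H →L[ℝ] H) {p : ℝ} (hp : 0 < p) (u w v : H) :
    0 ≤ energy P p u w v := by
  unfold energy; positivity

variable {B : H →ₗ.[ℝ] H} {P : H →L[ℝ] H} {p : ℝ} {u w v : ℝ → H}

theorem hasDeriv_potential (hp : 0 < p) {t : ℝ} (hu : HasDerivWithinAt u (v t) (Ici 0) t) :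
    HasDerivWithinAt (fun s => ‖P (u s)‖ ^ (p + 2) / (p + 2))
      (‖P (u t)‖ ^ p * ⟪P (u t), P (v t)⟫) (Ici 0) t := by
  have h1 : HasDerivWithinAt (fun s => P (u s)) (P (v t)) (Ici 0) t :=
    P.hasFDerivAt.comp_hasDerivWithinAt t hu
  refine ((hasDerivWithinAt_norm_rpow (q := p + 2) (by linarith) h1).div_const (p + 2)).congr_deriv ?_
  rw [add_sub_cancel_right]
  field_simp

variable [CompleteSpace H]

theorem IsDampedWave.hasDeriv_energy (hB : IsSelfAdjoint B) (hp : 0 < p)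
    (hP : ∀ x y, ⟪P x, P y⟫ = ⟪P x, y⟫) (h : IsDampedWave B P p u w v) {t : ℝ} (ht : 0 ≤ t) :
    HasDerivWithinAt (fun s => energy P p (u s) (w s) (v s)) (-‖v t‖ ^ 2) (Ici 0) t := by
  refine (((IsWeakWave.hasDeriv_energy hB h ht).div_const 2).add
    (hasDeriv_potential (P := P) hp (h.hasDeriv_u t ht))).congr_deriv ?_
  rw [hP, inner_sub_left, inner_neg_left, real_inner_smul_left, real_inner_self_eq_norm_sq]
  ring

theorem IsDampedWave.energy_le (hB : IsSelfAdjoint B) (hp : 0 < p)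
    (hP : ∀ x y, ⟪P x, P y⟫ = ⟪P x, y⟫) (h : IsDampedWave B P p u w v) {t : ℝ} (ht : 0 ≤ t) :
    energy P p (u t) (w t) (v t) ≤ energy P p (u 0) (w 0) (v 0) :=
  le_of_hasDerivWithinAt_nonpos (a' := fun t => -‖v t‖ ^ 2) le_rfl ht
    (fun r hr => h.hasDeriv_energy hB hp hP hr) (fun r _ _ => by simp)

/-- The truncated equation agrees with the true one while |Pu| ≤ R, and there the energy is
nonincreasing; reaching |Pu| = R would cost more than the initial energy. -/
theorem exists_isDampedWave (hB : IsSelfAdjoint B) (hp : 0 < p) (hPn : ∀ x, ‖P x‖ ≤ ‖x‖)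
    (hP : ∀ x y, ⟪P x, P y⟫ = ⟪P x, y⟫) {u₀ w₀ : H} (h₀ : (u₀, w₀) ∈ B.graph) (v₀ : H) :
    ∃ u w v : ℝ → H, IsDampedWave B P p u w v ∧ u 0 = u₀ ∧ v 0 = v₀ := by
  set E₀ := energy P p u₀ w₀ v₀ with hE₀
  have hE0 : 0 ≤ E₀ := energy_nonneg P hp _ _ _
  -- The added 1 makes the potential energy at |Pu| = R strictly larger than E₀.
  set R : ℝ := ((p + 2) * E₀ + 1) ^ (1 / (p + 2)) with hR
  have hR0 : 0 ≤ R := by positivity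
  have hRp : R ^ (p + 2) = (p + 2) * E₀ + 1 := by
    rw [hR, ← Real.rpow_mul (by positivity), one_div_mul_cancel (by positivity), Real.rpow_one]
  have hER : E₀ < R ^ (p + 2) / (p + 2) := by
    rw [lt_div_iff₀ (by positivity), hRp]; linarith
  obtain ⟨u, w, v, h, hu0, hv0⟩ := exists_isWeakWave_of_lipschitz hB
    (f := fun x => (min ‖P x‖ R) ^ p • P x) (K := (p + 2) * R ^ p) (by positivity)
    (fun x y => (norm_min_rpow_smul_sub_le hp hR0 (P x) (P y)).trans (by
      rw [← map_sub]; gcongr; exact hPn _)) h₀ v₀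
  have hw0 : w 0 = w₀ := by
    have h1 := h.mem_graph 0 le_rfl
    rw [hu0] at h1
    exact LinearPMap.mem_graph_snd_inj' B h1 h₀ rfl
  have hderiv : ∀ t, 0 ≤ t → HasDerivWithinAt (fun s => energy P p (u s) (w s) (v s))
      (-‖v t‖ ^ 2 + (‖P (u t)‖ ^ p - (min ‖P (u t)‖ R) ^ p) * ⟪P (u t), v t⟫) (Ici 0) t := by
    intro t ht
    refine (((h.hasDeriv_energy hB ht).div_const 2).add
      (hasDeriv_potential (P := P) hp (h.hasDeriv_u t ht))).congr_deriv ?_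
    rw [hP, inner_sub_left, inner_neg_left, real_inner_smul_left, real_inner_self_eq_norm_sq]
    ring
  have hPu : ContinuousOn (fun t => R - ‖P (u t)‖) (Ici 0) :=
    continuousOn_const.sub (P.continuous.comp_continuousOn h.continuousOn_u).norm
  have hbound : ∀ t, 0 ≤ t → ‖P (u t)‖ ≤ R := by
    intro t ht
    by_contra! hlt
    obtain ⟨T, hT0, hT, hTlt⟩ := exists_first_nonpos hPu ht (by linarith)
    have h1 := le_of_hasDerivWithinAt_nonpos le_rfl hT0 hderiv (fun r hr hrT => by
      have := hTlt r hr.le hrT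
      rw [min_eq_left (by linarith)]; simp)
    rw [hu0, hw0, hv0, ← hE₀] at h1
    have h2 : R ^ (p + 2) / (p + 2) ≤ ‖P (u T)‖ ^ (p + 2) / (p + 2) := by
      gcongr; linarith
    have h3 : 0 ≤ (‖v T‖ ^ 2 + ‖w T‖ ^ 2) / 2 := by positivity
    unfold energy at h1
    linarith
  have hg : ∀ t, 0 ≤ t → -v t - (min ‖P (u t)‖ R) ^ p • P (u t) =
      -v t - ‖P (u t)‖ ^ p • P (u t) := fun t ht => by rw [min_eq_left (hbound t ht)]
  refine ⟨u, w, v, ⟨h.continuousOn_w, h.continuousOn_v, ?_, h.mem_graph, h.hasDeriv_u, ?_⟩, hu0, hv0⟩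
  · exact h.continuousOn_g.congr fun t ht => (hg t ht).symm
  · intro φ φ' hφ t ht
    have := h.hasDeriv_v φ φ' hφ t ht
    simp only [hg t ht] at this
    exact this

theorem IsDampedWave.eqOn (hB : IsSelfAdjoint B) (hp : 0 < p) (hPn : ∀ x, ‖P x‖ ≤ ‖x‖)
    (h : IsDampedWave B P p u w v) {u₂ w₂ v₂ : ℝ → H} (h₂ : IsDampedWave B P p u₂ w₂ v₂)
    (hu0 : u 0 = u₂ 0) (hv0 : v 0 = v₂ 0) {t : ℝ} (ht : 0 ≤ t) : u t = u₂ t := by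
  have hw0 : w 0 = w₂ 0 := by
    have h1 := h.mem_graph 0 le_rfl
    have h2 := h₂.mem_graph 0 le_rfl
    rw [hu0] at h1
    exact LinearPMap.mem_graph_snd_inj' B h1 h2 rfl
  have hbd : ∀ {x : ℝ → H}, ContinuousOn x (Ici 0) → ∃ R, ∀ s, 0 ≤ s → s ≤ t → ‖P (x s)‖ ≤ R := by
    intro x hx
    obtain ⟨R, hR⟩ := isCompact_Icc.exists_bound_of_continuousOn
      ((hx.mono Icc_subset_Ici_self : ContinuousOn x (Icc 0 t)))
    exact ⟨R, fun s hs hst => (hPn _).trans (hR s ⟨hs, hst⟩)⟩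
  obtain ⟨R₁, hR₁⟩ := hbd h.continuousOn_u
  obtain ⟨R₂, hR₂⟩ := hbd h₂.continuousOn_u
  set R := max R₁ R₂
  have hR0 : 0 ≤ R := (norm_nonneg _).trans ((hR₁ 0 le_rfl ht).trans (le_max_left _ _))
  set K := (p + 2) * R ^ p with hK
  have hK0 : 0 ≤ K := by positivity
  have hsub := IsWeakWave.sub h h₂
  -- The last term is needed because |w - w₂| does not see the kernel of B.
  let e : ℝ → ℝ := fun s => ‖v s - v₂ s‖ ^ 2 + ‖w s - w₂ s‖ ^ 2 + ‖u s - u₂ s‖ ^ 2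
  have he : ∀ s, 0 ≤ s → HasDerivWithinAt (fun s => e s * Real.exp (-((K + 1) * s)))
      ((2 * ⟪(-v s - ‖P (u s)‖ ^ p • P (u s)) - (-v₂ s - ‖P (u₂ s)‖ ^ p • P (u₂ s)), v s - v₂ s⟫
        + 2 * ⟪u s - u₂ s, v s - v₂ s⟫ - (K + 1) * e s) * Real.exp (-((K + 1) * s))) (Ici 0) s := by
    intro s hs
    have h1 := (hsub.hasDeriv_energy hB hs).add (hsub.hasDeriv_u s hs).norm_sq
    have h2 : HasDerivAt (fun s => Real.exp (-((K + 1) * s)))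
        (Real.exp (-((K + 1) * s)) * (-((K + 1) * 1))) s :=
      (((hasDerivAt_id s).const_mul (K + 1)).neg).exp
    refine (h1.mul h2.hasDerivWithinAt).congr_deriv ?_
    simp only [Pi.add_apply, e]
    ring
  have hle := le_of_hasDerivWithinAt_nonpos le_rfl ht he (fun s hs hst => by
    refine mul_nonpos_of_nonpos_of_nonneg ?_ (Real.exp_pos _).le
    have h1 := norm_rpow_smul_sub_le hp ((hR₁ s hs.le hst.le).trans (le_max_left _ R₂))
      ((hR₂ s hs.le hst.le).trans (le_max_right R₁ _))
    rw [← hK, ← map_sub] at h1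
    have h2 : ‖‖P (u s)‖ ^ p • P (u s) - ‖P (u₂ s)‖ ^ p • P (u₂ s)‖ ≤ K * ‖u s - u₂ s‖ :=
      h1.trans (by gcongr; exact hPn _)
    have h3 : (-v s - ‖P (u s)‖ ^ p • P (u s)) - (-v₂ s - ‖P (u₂ s)‖ ^ p • P (u₂ s)) =
        -(v s - v₂ s) - (‖P (u s)‖ ^ p • P (u s) - ‖P (u₂ s)‖ ^ p • P (u₂ s)) := by abel
    rw [h3, inner_sub_left, inner_neg_left, real_inner_self_eq_norm_sq]
    have h4 := abs_le.1 (abs_real_inner_le_norm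
      (‖P (u s)‖ ^ p • P (u s) - ‖P (u₂ s)‖ ^ p • P (u₂ s)) (v s - v₂ s))
    have h5 := real_inner_le_norm (u s - u₂ s) (v s - v₂ s)
    have h6 := mul_le_mul_of_nonneg_right h2 (norm_nonneg (v s - v₂ s))
    have h7 := mul_nonneg hK0 (sq_nonneg (‖u s - u₂ s‖ - ‖v s - v₂ s‖))
    have h8 := mul_nonneg hK0 (sq_nonneg ‖w s - w₂ s‖)
    simp only [e]
    nlinarith [sq_nonneg (‖u s - u₂ s‖ - ‖v s - v₂ s‖), sq_nonneg ‖w s - w₂ s‖,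
      sq_nonneg ‖v s - v₂ s‖])
  simp only [e, hu0, hv0, hw0, sub_self, norm_zero] at hle
  have h1 := Real.exp_pos (-((K + 1) * t))
  have h2 : ‖u t - u₂ t‖ ^ 2 ≤ 0 := by
    by_contra! h3
    have : 0 < (‖v t - v₂ t‖ ^ 2 + ‖w t - w₂ t‖ ^ 2 + ‖u t - u₂ t‖ ^ 2) *
        Real.exp (-((K + 1) * t)) := by positivity
    norm_num at hle
    linarith
  have h3 : ‖u t - u₂ t‖ = 0 := by
    rwa [← pow_eq_zero_iff two_ne_zero, ← (sq_nonneg _).ge_iff_eq']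
  exact sub_eq_zero.1 (norm_eq_zero.1 h3)

end NonlinearWave

/-! ### Decay of all solutions -/

section Decay

/-- Young's inequality by cases on r^p ≥ 2b. The remainder has order b^{1+2/p}, which fixes the
decay rate. -/
theorem mul_sq_le_rpow_add {p r b : ℝ} (hp : 0 < p) (hr : 0 ≤ r) (hb : 0 ≤ b) :
    b * r ^ 2 ≤ r ^ (p + 2) / 2 + b * (2 * b) ^ (2 / p) := by
  have h0 : r ^ (p + 2) = r ^ p * r ^ 2 := by
    rw [Real.rpow_add' hr (by positivity), Real.rpow_two]
  rcases le_total (2 * b) (r ^ p) with h | h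
  · have h1 : 0 ≤ b * (2 * b) ^ (2 / p) := by positivity
    rw [h0]
    nlinarith [mul_le_mul_of_nonneg_right h (sq_nonneg r)]
  · have h1 : r ^ 2 ≤ (2 * b) ^ (2 / p) := by
      have h2 : (r ^ p) ^ (2 / p) ≤ (2 * b) ^ (2 / p) := by gcongr
      rwa [← Real.rpow_mul hr, mul_div_cancel₀ _ hp.ne', Real.rpow_two] at h2
    have h3 : 0 ≤ r ^ (p + 2) := by positivity
    nlinarith [mul_le_mul_of_nonneg_left h1 hb]

/-- Here a = σ/(s₀+t), so a' = -a²/σ, and V, Y, r, X stand for |v|², |w|², |Pu|, |u|². The left side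
is W' + aW for W = E + aZ, where aW comes from the weight (s₀+t)^σ. -/
theorem lyapunov_deriv_le {p σ C₀ a V Y r X Z : ℝ} (hp : 0 < p) (hσ : σ = 2 + 2 / p)
    (hC₀ : 0 < C₀) (ha : 0 < a) (ha' : a * (1 + C₀) ≤ 1 / 2) (hV : 0 ≤ V) (hY : 0 ≤ Y) (hr : 0 ≤ r)
    (hX : 0 ≤ X) (hXC : X ≤ C₀ * (Y + r ^ 2)) (hZ : Z ≤ V / 2 + X) :
    -V + (a * (V - Y - r ^ (p + 2)) - a ^ 2 / σ * Z) +
      a * ((V + Y) / 2 + r ^ (p + 2) / (p + 2) + a * Z) ≤ C₀ * (2 * C₀) ^ (2 / p) * a ^ σ := by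
  have hσ2 : 2 < σ := by
    have : 0 < 2 / p := by positivity
    linarith
  have ha1 : a ≤ 1 / 2 := by nlinarith
  have haC : a * C₀ ≤ 1 / 2 := by nlinarith
  have hy := mul_sq_le_rpow_add (b := a * C₀) hp hr (by positivity)
  have haσ : a * (a * C₀ * (2 * (a * C₀)) ^ (2 / p)) = C₀ * (2 * C₀) ^ (2 / p) * a ^ σ := by
    rw [show 2 * (a * C₀) = a * (2 * C₀) by ring, Real.mul_rpow ha.le (by positivity), hσ,
      Real.rpow_add ha, Real.rpow_two]
    ring
  have e2 : -V + (a * (V - Y - r ^ (p + 2)) - a ^ 2 / σ * Z) +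
      a * ((V + Y) / 2 + r ^ (p + 2) / (p + 2) + a * Z) =
      -V + a * (3 / 2 * V - Y / 2 - (1 - 1 / (p + 2)) * r ^ (p + 2)) +
        a ^ 2 * (1 - 1 / σ) * Z := by ring
  have e3 : a ^ 2 * (1 - 1 / σ) * Z ≤ a ^ 2 * (V / 2 + X) := by
    have f1 : 0 ≤ 1 - 1 / σ := by
      rw [sub_nonneg, div_le_one (by linarith)]; linarith
    have f2 : 1 - 1 / σ ≤ 1 := by
      have : 0 < 1 / σ := by positivity
      linarith
    have f3 : 0 ≤ V / 2 + X := by positivity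
    calc a ^ 2 * (1 - 1 / σ) * Z ≤ a ^ 2 * (1 - 1 / σ) * (V / 2 + X) := by gcongr
      _ ≤ a ^ 2 * 1 * (V / 2 + X) := by gcongr
      _ = _ := by ring
  have e4 : a * (1 / 2 * r ^ (p + 2)) ≤ a * ((1 - 1 / (p + 2)) * r ^ (p + 2)) := by
    have : 1 / (p + 2) ≤ 1 / 2 := one_div_le_one_div_of_le (by norm_num) (by linarith)
    gcongr; linarith
  have e5 : a ^ 2 * X ≤ a ^ 2 * (C₀ * (Y + r ^ 2)) := by gcongr
  have e6 := mul_le_mul_of_nonneg_left hy ha.le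
  have e7 : a * (a * C₀) * Y ≤ a * (1 / 2) * Y := by gcongr
  have e8 : a * V ≤ 1 / 2 * V := by gcongr
  have e9 : a * (a * V) ≤ 1 / 2 * (1 / 2 * V) := by gcongr
  rw [e2, ← haσ]
  linarith

variable {H : Type*} [NormedAddCommGroup H] [InnerProductSpace ℝ H]
  {B : H →ₗ.[ℝ] H} {P : H →L[ℝ] H} {p : ℝ} {u w v : ℝ → H}

theorem inner_rpow_smul_self (hp : 0 < p) (hP : ∀ x y, ⟪P x, P y⟫ = ⟪P x, y⟫) (x : H) :
    ⟪‖P x‖ ^ p • P x, x⟫ = ‖P x‖ ^ (p + 2) := by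
  rw [real_inner_smul_left, ← hP, real_inner_self_eq_norm_sq,
    Real.rpow_add' (norm_nonneg _) (by positivity), Real.rpow_two]

theorem IsDampedWave.hasDeriv_inner_add (hp : 0 < p) (hP : ∀ x y, ⟪P x, P y⟫ = ⟪P x, y⟫)
    (h : IsDampedWave B P p u w v) {t : ℝ} (ht : 0 ≤ t) :
    HasDerivWithinAt (fun s => ⟪u s, v s⟫ + ‖u s‖ ^ 2 / 2)
      (‖v t‖ ^ 2 - ‖w t‖ ^ 2 - ‖P (u t)‖ ^ (p + 2)) (Ici 0) t := by
  have hu := h.hasDeriv_u t ht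
  refine ((h.hasDeriv_inner ht hu (h.mem_graph t ht)).add (hu.norm_sq.div_const 2)).congr_deriv ?_
  rw [inner_sub_left, inner_neg_left, inner_rpow_smul_self hp hP, real_inner_self_eq_norm_sq,
    real_inner_self_eq_norm_sq, real_inner_comm (u t)]
  ring

theorem sq_norm_le_of_energy_le {C₀ b : ℝ} (hp : 0 < p) (hC₀ : 0 ≤ C₀)
    {x y z : H} (hx : ‖x‖ ^ 2 ≤ C₀ * (‖y‖ ^ 2 + ‖P x‖ ^ 2)) (hb : energy P p x y z ≤ b) :
    ‖x‖ ^ 2 ≤ C₀ * (2 * b + ((p + 2) * b) ^ (2 / (p + 2))) := by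
  unfold energy at hb
  have h1 : 0 ≤ ‖P x‖ ^ (p + 2) / (p + 2) := by positivity
  have h2 : 0 ≤ ‖z‖ ^ 2 := by positivity
  have h3 : ‖P x‖ ^ (p + 2) ≤ (p + 2) * b := by
    have : ‖P x‖ ^ (p + 2) / (p + 2) ≤ b := by nlinarith [sq_nonneg ‖y‖]
    rw [div_le_iff₀ (by positivity)] at this
    linarith
  have h4 : ‖P x‖ ^ 2 ≤ ((p + 2) * b) ^ (2 / (p + 2)) := by
    have h5 : (‖P x‖ ^ (p + 2)) ^ (2 / (p + 2)) ≤ ((p + 2) * b) ^ (2 / (p + 2)) := by gcongr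
    rwa [← Real.rpow_mul (norm_nonneg _), mul_div_cancel₀ _ (by positivity), Real.rpow_two] at h5
  refine hx.trans ?_
  gcongr
  linarith

variable [CompleteSpace H]

/-- (s₀+t)^σ W has derivative at most K₁, hence grows at most linearly; as E ≤ 2W, this gives the
exponent 1 - σ = -(1 + 2/p). -/
theorem exists_energy_decay_bound (hB : IsSelfAdjoint B) (hp : 0 < p)
    (hP : ∀ x y, ⟪P x, P y⟫ = ⟪P x, y⟫) {C₀ : ℝ} (hC₀ : 0 < C₀)
    (hcoer : ∀ x y, (x, y) ∈ B.graph → ‖x‖ ^ 2 ≤ C₀ * (‖y‖ ^ 2 + ‖P x‖ ^ 2)) {ρ : ℝ} (hρ : 0 ≤ ρ) :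
    ∃ s₀ K : ℝ, 1 ≤ s₀ ∧ 0 ≤ K ∧ ∀ u w v : ℝ → H, IsDampedWave B P p u w v →
      energy P p (u 0) (w 0) (v 0) ≤ ρ → ‖u 0‖ ^ 2 ≤ ρ →
        ∀ t, 0 ≤ t → energy P p (u t) (w t) (v t) ≤ 2 * K * (s₀ + t) ^ (-(1 + 2 / p)) := by
  set σ : ℝ := 2 + 2 / p with hσ
  have hσ2 : 2 < σ := by
    have : 0 < 2 / p := by positivity
    linarith
  -- This is the smallest shift for which a(1 + C₀) ≤ 1/2 already at t = 0.
  set s₀ : ℝ := 2 * σ * (1 + C₀) with hs₀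
  have hs₀1 : 1 ≤ s₀ := by nlinarith
  set K₁ : ℝ := C₀ * (2 * C₀) ^ (2 / p) * σ ^ σ with hK₁
  set K₂ : ℝ := s₀ ^ σ * (3 * ρ) + K₁ with hK₂
  have hK₁0 : 0 ≤ K₁ := by positivity
  have hK₂0 : 0 ≤ K₂ := by positivity
  refine ⟨s₀, K₂, hs₀1, hK₂0, fun u w v h hE0 hu0 t ht => ?_⟩
  have hs : ∀ r, 0 ≤ r → 0 < s₀ + r := fun r hr => by linarith
  let Z : ℝ → ℝ := fun r => ⟪u r, v r⟫ + ‖u r‖ ^ 2 / 2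
  let E : ℝ → ℝ := fun r => energy P p (u r) (w r) (v r)
  let W : ℝ → ℝ := fun r => E r + σ / (s₀ + r) * Z r
  have hZup : ∀ r, Z r ≤ ‖v r‖ ^ 2 / 2 + ‖u r‖ ^ 2 := fun r => by
    have h1 := real_inner_le_norm (u r) (v r)
    simp only [Z]
    nlinarith [sq_nonneg (‖u r‖ - ‖v r‖)]
  have hZlow : ∀ r, -(‖v r‖ ^ 2 / 2) ≤ Z r := fun r => by
    have h1 := (abs_le.1 (abs_real_inner_le_norm (u r) (v r))).1
    simp only [Z]
    nlinarith [sq_nonneg (‖u r‖ - ‖v r‖)]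
  have hvE : ∀ r, ‖v r‖ ^ 2 / 2 ≤ E r := fun r => by
    have : 0 ≤ ‖w r‖ ^ 2 / 2 + ‖P (u r)‖ ^ (p + 2) / (p + 2) := by positivity
    simp only [E, energy]
    linarith
  have ha0 : ∀ r, 0 ≤ r → 0 < σ / (s₀ + r) := fun r hr => div_pos (by linarith) (hs r hr)
  have ha : ∀ r, 0 ≤ r → σ / (s₀ + r) * (1 + C₀) ≤ 1 / 2 := fun r hr => by
    rw [div_mul_eq_mul_div, div_le_iff₀ (hs r hr)]
    nlinarith
  have hderiv : ∀ r, 0 ≤ r → HasDerivWithinAt (fun r => (s₀ + r) ^ σ * W r - K₁ * r)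
      ((s₀ + r) ^ σ * (-‖v r‖ ^ 2 + (σ / (s₀ + r) *
        (‖v r‖ ^ 2 - ‖w r‖ ^ 2 - ‖P (u r)‖ ^ (p + 2)) - σ / (s₀ + r) ^ 2 * Z r) +
          σ / (s₀ + r) * W r) - K₁) (Ici 0) r := by
    intro r hr
    have hs' := (hs r hr).ne'
    have h0 : HasDerivAt (fun r => s₀ + r) 1 r := (hasDerivAt_id r).const_add s₀
    have h1 : HasDerivAt (fun r => (s₀ + r) ^ σ) (σ * (s₀ + r) ^ (σ - 1)) r := by
      simpa using h0.rpow_const (p := σ) (Or.inl hs')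
    have h2 : HasDerivAt (fun r => σ / (s₀ + r)) (-σ / (s₀ + r) ^ 2) r := by
      exact ((hasDerivAt_const r σ).div h0 hs').congr_deriv (by simp)
    have h3 := (h.hasDeriv_energy hB hp hP hr).add
      (h2.hasDerivWithinAt.mul (h.hasDeriv_inner_add hp hP hr))
    have h4 := (h1.hasDerivWithinAt.mul h3).sub (((hasDerivAt_id r).const_mul K₁).hasDerivWithinAt)
    refine h4.congr_deriv ?_
    rw [Real.rpow_sub_one hs']
    simp only [W, E, Z, Pi.add_apply, Pi.mul_apply]
    field_simp
    ring
  have hneg : ∀ r, 0 < r → r < t → (s₀ + r) ^ σ * (-‖v r‖ ^ 2 + (σ / (s₀ + r) *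
        (‖v r‖ ^ 2 - ‖w r‖ ^ 2 - ‖P (u r)‖ ^ (p + 2)) - σ / (s₀ + r) ^ 2 * Z r) +
          σ / (s₀ + r) * W r) - K₁ ≤ 0 := by
    intro r hr _
    set a := σ / (s₀ + r) with haDef
    have ha0' : 0 < a := ha0 r hr.le
    have ha' : a * (1 + C₀) ≤ 1 / 2 := ha r hr.le
    have hsa : (s₀ + r) ^ σ * a ^ σ = σ ^ σ := by
      rw [← Real.mul_rpow (hs r hr.le).le ha0'.le, haDef, mul_div_cancel₀ _ (hs r hr.le).ne']
    have e1 : σ / (s₀ + r) ^ 2 = a ^ 2 / σ := by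
      rw [haDef]; field_simp
    have hmain := lyapunov_deriv_le hp hσ hC₀ ha0' ha' (sq_nonneg ‖v r‖) (sq_nonneg ‖w r‖)
      (norm_nonneg (P (u r))) (sq_nonneg ‖u r‖) (hcoer _ _ (h.mem_graph r hr.le)) (hZup r)
    rw [← e1] at hmain
    have := mul_le_mul_of_nonneg_left hmain (by have := hs r hr.le; positivity : 0 ≤ (s₀ + r) ^ σ)
    simp only [W, E, energy]
    rw [← haDef]
    have e10 : (s₀ + r) ^ σ * (C₀ * (2 * C₀) ^ (2 / p) * a ^ σ) = K₁ := by
      rw [hK₁, ← hsa]; ring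
    linarith
  have hmono := le_of_hasDerivWithinAt_nonpos le_rfl ht hderiv hneg
  have hst := hs t ht
  have hW0 : W 0 ≤ 3 * ρ := by
    have f1 : σ / (s₀ + 0) ≤ 1 := by have := ha 0 le_rfl; have := ha0 0 le_rfl; nlinarith
    have f2 : σ / (s₀ + 0) * Z 0 ≤ σ / (s₀ + 0) * (‖v 0‖ ^ 2 / 2 + ‖u 0‖ ^ 2) :=
      mul_le_mul_of_nonneg_left (hZup 0) (ha0 0 le_rfl).le
    have f3 : σ / (s₀ + 0) * (‖v 0‖ ^ 2 / 2 + ‖u 0‖ ^ 2) ≤ 1 * (‖v 0‖ ^ 2 / 2 + ‖u 0‖ ^ 2) := by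
      gcongr
    have f4 := hvE 0
    simp only [W]
    simp only [E] at f4 ⊢
    linarith
  have hWE : E t / 2 ≤ W t := by
    have f1 : σ / (s₀ + t) ≤ 1 / 2 := by have := ha t ht; have := ha0 t ht; nlinarith
    have f2 : σ / (s₀ + t) * -(‖v t‖ ^ 2 / 2) ≤ σ / (s₀ + t) * Z t :=
      mul_le_mul_of_nonneg_left (hZlow t) (ha0 t ht).le
    have f3 : σ / (s₀ + t) * (‖v t‖ ^ 2 / 2) ≤ 1 / 2 * (‖v t‖ ^ 2 / 2) := by gcongr
    have f4 := hvE t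
    simp only [W]
    linarith
  have hWt : (s₀ + t) ^ σ * W t ≤ K₂ * (s₀ + t) := by
    have g1 : (s₀ + 0) ^ σ * W 0 ≤ s₀ ^ σ * (3 * ρ) := by rw [add_zero]; gcongr
    have g2 : s₀ ^ σ * (3 * ρ) * 1 ≤ s₀ ^ σ * (3 * ρ) * (s₀ + t) := by gcongr; linarith
    have g3 : K₁ * t ≤ K₁ * (s₀ + t) := by gcongr; linarith
    rw [hK₂, add_mul]
    linarith
  have g1 : (s₀ + t) ^ (-(1 + 2 / p)) * (s₀ + t) ^ σ = s₀ + t := by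
    rw [← Real.rpow_add hst, hσ]
    conv_rhs => rw [← Real.rpow_one (s₀ + t)]
    congr 1; ring
  have g2 : (s₀ + t) ^ σ * (E t / 2) ≤ K₂ * (s₀ + t) := le_trans (by gcongr) hWt
  have g3 : 0 < (s₀ + t) ^ σ := by positivity
  refine le_of_mul_le_mul_right ?_ g3
  change E t * _ ≤ _
  calc E t * (s₀ + t) ^ σ = 2 * ((s₀ + t) ^ σ * (E t / 2)) := by ring
    _ ≤ 2 * (K₂ * (s₀ + t)) := by gcongr
    _ = 2 * K₂ * ((s₀ + t) ^ (-(1 + 2 / p)) * (s₀ + t) ^ σ) := by rw [g1]; ring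
    _ = _ := by ring

/-- Coercivity bounds |u|² by E and E^{2/(p+2)}. The second term dominates, with exponent (1 +
2/p)·2/(p+2) = 2/p. M depends only on ρ, as the open set requires. -/
theorem exists_decay_bound (hB : IsSelfAdjoint B) (hp : 0 < p)
    (hP : ∀ x y, ⟪P x, P y⟫ = ⟪P x, y⟫) {C₀ : ℝ} (hC₀ : 0 < C₀)
    (hcoer : ∀ x y, (x, y) ∈ B.graph → ‖x‖ ^ 2 ≤ C₀ * (‖y‖ ^ 2 + ‖P x‖ ^ 2)) {ρ : ℝ} (hρ : 0 ≤ ρ) :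
    ∃ M : ℝ, 0 < M ∧ ∀ u w v : ℝ → H, IsDampedWave B P p u w v →
      energy P p (u 0) (w 0) (v 0) ≤ ρ → ‖u 0‖ ^ 2 ≤ ρ →
        ∀ t, 0 ≤ t → ‖u t‖ ≤ M / (1 + t) ^ (1 / p) := by
  obtain ⟨s₀, K₂, hs₀1, hK₂0, hdecay⟩ := exists_energy_decay_bound hB hp hP hC₀ hcoer hρ
  set K₃ : ℝ := C₀ * (4 * K₂ + ((p + 2) * (2 * K₂)) ^ (2 / (p + 2))) with hK₃
  have hK₃0 : 0 ≤ K₃ := by positivity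
  refine ⟨Real.sqrt K₃ + 1, by positivity, fun u w v h hE0 hu0 t ht => ?_⟩
  have hEt := hdecay u w v h hE0 hu0 t ht
  have hst : 0 < s₀ + t := by linarith
  have hfin := sq_norm_le_of_energy_le hp hC₀.le (hcoer _ _ (h.mem_graph t ht)) hEt
  have hpow : ((p + 2) * (2 * K₂ * (s₀ + t) ^ (-(1 + 2 / p)))) ^ (2 / (p + 2)) =
      ((p + 2) * (2 * K₂)) ^ (2 / (p + 2)) * (s₀ + t) ^ (-(2 / p)) := by
    rw [← mul_assoc, Real.mul_rpow (by positivity) (by positivity), ← Real.rpow_mul hst.le]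
    congr 2
    field_simp
  have hpow2 : (s₀ + t) ^ (-(1 + 2 / p)) ≤ (s₀ + t) ^ (-(2 / p)) :=
    Real.rpow_le_rpow_of_exponent_le (by linarith) (by linarith)
  have hpow3 : (s₀ + t) ^ (-(2 / p)) ≤ (1 + t) ^ (-(2 / p)) :=
    Real.rpow_le_rpow_of_nonpos (by linarith) (by linarith) (by
      rw [neg_nonpos]; positivity)
  rw [hpow] at hfin
  have hsq : ‖u t‖ ^ 2 ≤ K₃ * (1 + t) ^ (-(2 / p)) := by
    refine hfin.trans ?_
    calc C₀ * (2 * (2 * K₂ * (s₀ + t) ^ (-(1 + 2 / p))) +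
          ((p + 2) * (2 * K₂)) ^ (2 / (p + 2)) * (s₀ + t) ^ (-(2 / p)))
        ≤ C₀ * (2 * (2 * K₂ * (s₀ + t) ^ (-(2 / p))) +
          ((p + 2) * (2 * K₂)) ^ (2 / (p + 2)) * (s₀ + t) ^ (-(2 / p))) := by gcongr
      _ = K₃ * (s₀ + t) ^ (-(2 / p)) := by rw [hK₃]; ring
      _ ≤ K₃ * (1 + t) ^ (-(2 / p)) := by gcongr
  have h1t : 0 < 1 + t := by linarith
  have hsqrt : ((1 + t) ^ (1 / p)) ^ 2 * (1 + t) ^ (-(2 / p)) = 1 := by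
    rw [← Real.rpow_natCast, ← Real.rpow_mul h1t.le, ← Real.rpow_add h1t,
      show 1 / p * ((2 : ℕ) : ℝ) + -(2 / p) = 0 by push_cast; ring, Real.rpow_zero]
  rw [le_div_iff₀ (by positivity)]
  have hle : ‖u t‖ * (1 + t) ^ (1 / p) ≤ Real.sqrt K₃ := by
    refine Real.le_sqrt_of_sq_le ?_
    rw [mul_pow]
    calc ‖u t‖ ^ 2 * ((1 + t) ^ (1 / p)) ^ 2
        ≤ K₃ * (1 + t) ^ (-(2 / p)) * ((1 + t) ^ (1 / p)) ^ 2 := by gcongr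
      _ = K₃ * (((1 + t) ^ (1 / p)) ^ 2 * (1 + t) ^ (-(2 / p))) := by ring
      _ = K₃ := by rw [hsqrt, mul_one]
  linarith

end Decay

/-! ### The invariant region and the lower bound -/

section SlowSolutions

variable {H : Type*} [NormedAddCommGroup H] [InnerProductSpace ℝ H]

theorem mul_le_add_of_sq_le {κ a b Y : ℝ} (hκ : 0 < κ) (hb : b ^ 2 ≤ κ * Y) :
    a * b ≤ κ * a ^ 2 + Y / 4 := by
  have h1 : 4 * κ * (a * b) ≤ 4 * κ * (κ * a ^ 2 + Y / 4) := by
    nlinarith [sq_nonneg (2 * κ * a - b)]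
  exact le_of_mul_le_mul_left h1 (by positivity)

/-- The modified energy, in which `N` projects on the kernel of the operator. -/
def modEnergy (N : H →L[ℝ] H) (ε : ℝ) (u w v : H) : ℝ :=
  (‖v‖ ^ 2 + ‖w‖ ^ 2) / 2 + ε * ⟪u - N u, v⟫

theorem modEnergy_bounds {N : H →L[ℝ] H} {ε κ : ℝ} (hκ : 0 < κ) (hε : 0 < ε)
    (hεκ : ε * (1 + κ) ≤ 1 / 4) {u w v : H} (hq : ‖u - N u‖ ^ 2 ≤ κ * ‖w‖ ^ 2) :
    (‖v‖ ^ 2 + ‖w‖ ^ 2) / 4 ≤ modEnergy N ε u w v ∧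
      modEnergy N ε u w v ≤ ‖v‖ ^ 2 + ‖w‖ ^ 2 := by
  have h1 := abs_le.1 (abs_real_inner_le_norm (u - N u) v)
  have h2 := mul_le_add_of_sq_le (a := ‖v‖) hκ hq
  have hε1 : ε ≤ 1 / 4 := by nlinarith
  have hεκ' : ε * κ ≤ 1 / 4 := by nlinarith
  have h3 : ε * (κ * ‖v‖ ^ 2 + ‖w‖ ^ 2 / 4) ≤ 1 / 4 * ‖v‖ ^ 2 + 1 / 4 * (‖w‖ ^ 2 / 4) := by
    rw [mul_add, ← mul_assoc]; gcongr
  have h4 : ε * ⟪u - N u, v⟫ ≤ ε * (κ * ‖v‖ ^ 2 + ‖w‖ ^ 2 / 4) := by gcongr; linarith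
  have h5 : ε * (-(κ * ‖v‖ ^ 2 + ‖w‖ ^ 2 / 4)) ≤ ε * ⟪u - N u, v⟫ := by gcongr; linarith
  unfold modEnergy
  constructor <;> nlinarith [sq_nonneg ‖v‖, sq_nonneg ‖w‖]

/-- The damping dissipates |v|², and the cross term with q = u - Nu supplies the missing -ε|w|².
Removing the kernel part makes |q| controlled by |w|. -/
theorem modEnergy_deriv_le {ε κ : ℝ} (hκ : 0 < κ) (hε : 0 < ε)
    (hεκ : ε * (1 + κ) ≤ 1 / 4) {q q' w v f : H} (hq : ‖q‖ ^ 2 ≤ κ * ‖w‖ ^ 2)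
    (hq' : ⟪q', v⟫ ≤ ‖v‖ ^ 2) :
    ⟪-v - f, v⟫ + ε * (⟪q', v⟫ + (-⟪w, w⟫ + ⟪-v - f, q⟫)) ≤
      -(ε / 2) * (‖v‖ ^ 2 + ‖w‖ ^ 2) + 2 * ‖f‖ ^ 2 := by
  rw [inner_sub_left, inner_neg_left, inner_sub_left, inner_neg_left, real_inner_self_eq_norm_sq,
    real_inner_self_eq_norm_sq]
  have h1 := (abs_le.1 (abs_real_inner_le_norm v q)).1
  have h2 := (abs_le.1 (abs_real_inner_le_norm f q)).1
  have h3 := (abs_le.1 (abs_real_inner_le_norm f v)).1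
  have h4 := mul_le_add_of_sq_le (a := ‖v‖) hκ hq
  have h5 := mul_le_add_of_sq_le (a := ‖f‖) hκ hq
  have hε1 : ε ≤ 1 / 4 := by nlinarith
  have hεκ' : ε * κ ≤ 1 / 4 := by nlinarith
  have h6 : ε * (⟪q', v⟫ + (-‖w‖ ^ 2 + (-⟪v, q⟫ - ⟪f, q⟫))) ≤
      ε * (‖v‖ ^ 2 + (-‖w‖ ^ 2 + ((κ * ‖v‖ ^ 2 + ‖w‖ ^ 2 / 4) + (κ * ‖f‖ ^ 2 + ‖w‖ ^ 2 / 4)))) := by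
    gcongr; linarith
  have h7 : ε * (1 + κ) * ‖v‖ ^ 2 ≤ 1 / 4 * ‖v‖ ^ 2 := by gcongr
  have h8 : ε * κ * ‖f‖ ^ 2 ≤ 1 / 4 * ‖f‖ ^ 2 := by gcongr
  have h9 : ε * ‖v‖ ^ 2 ≤ 1 / 4 * ‖v‖ ^ 2 := by gcongr
  nlinarith [sq_nonneg (2 * ‖f‖ - ‖v‖), sq_nonneg ‖f‖, sq_nonneg ‖v‖]

theorem norm_rpow_smul_sq_le {P : H →L[ℝ] H} {p : ℝ} (hp : 0 < p) (hPn : ∀ x, ‖P x‖ ≤ ‖x‖) (x : H) :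
    ‖‖P x‖ ^ p • P x‖ ^ 2 ≤ ‖x‖ ^ (2 * p + 2) := by
  have h1 : ‖‖P x‖ ^ p • P x‖ ≤ ‖x‖ ^ p * ‖x‖ := by
    rw [norm_smul, Real.norm_of_nonneg (by positivity)]
    gcongr <;> exact hPn x
  have h2 : ‖x‖ ^ (2 * p + 2) = (‖x‖ ^ p * ‖x‖) ^ 2 := by
    rw [Real.rpow_add' (norm_nonneg _) (by positivity), Real.rpow_two, mul_pow,
      ← Real.rpow_mul_natCast (norm_nonneg _), mul_comm 2 p, Nat.cast_ofNat]
  rw [h2]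
  gcongr

theorem norm_le_of_modEnergy_lt {N : H →L[ℝ] H} {ε κ K p : ℝ} (hp : 0 < p) (hκ : 0 < κ) (hε : 0 < ε)
    (hεκ : ε * (1 + κ) ≤ 1 / 4) (hK : 0 < K) {u w v : H} (hq : ‖u - N u‖ ^ 2 ≤ κ * ‖w‖ ^ 2)
    (h : modEnergy N ε u w v < K * ‖u‖ ^ (2 * p + 2)) : ‖v‖ ≤ 2 * √K * (‖u‖ ^ p * ‖u‖) := by
  have h1 := (modEnergy_bounds hκ hε hεκ (v := v) hq).1
  refine le_of_sq_le_sq ?_ (by positivity)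
  have h2 : ‖u‖ ^ (2 * p + 2) = (‖u‖ ^ p * ‖u‖) ^ 2 := by
    rw [Real.rpow_add' (norm_nonneg _) (by positivity), Real.rpow_two, mul_pow,
      ← Real.rpow_mul_natCast (norm_nonneg _), mul_comm 2 p, Nat.cast_ofNat]
  rw [mul_pow, mul_pow, Real.sq_sqrt hK.le, ← h2]
  nlinarith [sq_nonneg ‖w‖]

variable [CompleteSpace H] {B : H →ₗ.[ℝ] H} {P N : H →L[ℝ] H} {p : ℝ} {u w v : ℝ → H}

/-- While the gap D is positive, D' ≥ -(ε/2)D, so D exp(εt/2) is nondecreasing and D cannot reach 0.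
-/
theorem IsDampedWave.modEnergy_lt (hB : IsSelfAdjoint B) (hp : 0 < p) (hPn : ∀ x, ‖P x‖ ≤ ‖x‖)
    (hN : ∀ x, (N x, 0) ∈ B.graph) (hNpos : ∀ x, 0 ≤ ⟪N x, x⟫) {ε κ K δ : ℝ} (hκ : 0 < κ)
    (hε : 0 < ε) (hεκ : ε * (1 + κ) ≤ 1 / 4)
    (hcoer : ∀ x y, (x, y) ∈ B.graph → ‖x - N x‖ ^ 2 ≤ κ * ‖y‖ ^ 2)
    (hK : K = 8 / ε) (hKδ : K * ((4 * p + 4) * √K * δ ^ p) ≤ 2)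
    (h : IsDampedWave B P p u w v) (hδ : ∀ t, 0 ≤ t → ‖u t‖ ≤ δ)
    (h0 : modEnergy N ε (u 0) (w 0) (v 0) < K * ‖u 0‖ ^ (2 * p + 2)) {t : ℝ} (ht : 0 ≤ t) :
    modEnergy N ε (u t) (w t) (v t) < K * ‖u t‖ ^ (2 * p + 2) := by
  have hK0 : 0 < K := by rw [hK]; positivity
  have hεK : ε / 2 * K = 4 := by rw [hK]; field_simp; norm_num
  have hcoer' : ∀ s, 0 ≤ s → ‖u s - N (u s)‖ ^ 2 ≤ κ * ‖w s‖ ^ 2 :=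
    fun s hs => hcoer _ _ (h.mem_graph s hs)
  let f : ℝ → H := fun s => ‖P (u s)‖ ^ p • P (u s)
  let D : ℝ → ℝ := fun s => K * ‖u s‖ ^ (2 * p + 2) - modEnergy N ε (u s) (w s) (v s)
  let D' : ℝ → ℝ := fun s => K * ((2 * p + 2) * ‖u s‖ ^ (2 * p) * ⟪u s, v s⟫) -
    (⟪-v s - f s, v s⟫ + ε * (⟪v s - N (v s), v s⟫ + (-⟪w s, w s⟫ +
      ⟪-v s - f s, u s - N (u s)⟫)))
  have hD : ∀ s, 0 ≤ s → HasDerivWithinAt D (D' s) (Ici 0) s := by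
    intro s hs
    have hu := h.hasDeriv_u s hs
    have h1 := (hasDerivWithinAt_norm_rpow (q := 2 * p + 2) (by linarith) hu).const_mul K
    have hq : HasDerivWithinAt (fun s => u s - N (u s)) (v s - N (v s)) (Ici 0) s :=
      hu.sub (N.hasFDerivAt.comp_hasDerivWithinAt s hu)
    have hg : (u s - N (u s), w s) ∈ B.graph := by
      simpa using graph_sub (h.mem_graph s hs) (hN (u s))
    have h2 := ((IsWeakWave.hasDeriv_energy hB h hs).div_const 2).add
      ((h.hasDeriv_inner hs hq hg).const_mul ε)
    refine (h1.sub h2).congr_deriv ?_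
    simp only [D', f, add_sub_cancel_right]
    ring
  -- With Λ = |u|^{2p+2}, the motion of KΛ costs at most 2Λ by smallness of δ and the forcing at
  -- most 2Λ. The total 4Λ equals (ε/2)KΛ, whence K = 8/ε.
  have hDpos : ∀ s, 0 ≤ s → 0 < D s → -(ε / 2) * D s ≤ D' s := by
    intro s hs hDs
    have h1 : ⟪v s - N (v s), v s⟫ ≤ ‖v s‖ ^ 2 := by
      rw [inner_sub_left, real_inner_self_eq_norm_sq]; linarith [hNpos (v s)]
    have h2 := modEnergy_deriv_le (f := f s) hκ hε hεκ (hcoer' s hs) h1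
    have h3 := norm_rpow_smul_sq_le hp hPn (u s)
    have h4 := (modEnergy_bounds hκ hε hεκ (v := v s) (hcoer' s hs)).2
    have h5 := norm_le_of_modEnergy_lt (p := p) hp hκ hε hεκ hK0 (hcoer' s hs) (sub_pos.1 hDs)
    have h6 := (abs_le.1 (abs_real_inner_le_norm (u s) (v s))).1
    set Λ := ‖u s‖ ^ (2 * p + 2) with hΛ
    have hΛ0 : 0 ≤ Λ := by positivity
    have h7 : ‖u s‖ ^ (2 * p) * (‖u s‖ * (‖u s‖ ^ p * ‖u s‖)) = ‖u s‖ ^ p * Λ := by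
      rw [hΛ, Real.rpow_add' (norm_nonneg _) (by positivity), Real.rpow_two]; ring
    have h8 : -(‖u s‖ * (2 * √K * (‖u s‖ ^ p * ‖u s‖))) ≤ ⟪u s, v s⟫ := by
      refine le_trans ?_ h6
      gcongr
    have h9 : -(K * ((4 * p + 4) * √K * ‖u s‖ ^ p) * Λ) ≤
        K * ((2 * p + 2) * ‖u s‖ ^ (2 * p) * ⟪u s, v s⟫) := by
      calc -(K * ((4 * p + 4) * √K * ‖u s‖ ^ p) * Λ)
          = K * ((2 * p + 2) * ‖u s‖ ^ (2 * p) *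
              -(‖u s‖ * (2 * √K * (‖u s‖ ^ p * ‖u s‖)))) := by
            linear_combination (K * (4 * p + 4) * √K) * h7
        _ ≤ _ := by gcongr
    have h10 : K * ((4 * p + 4) * √K * ‖u s‖ ^ p) * Λ ≤ 2 * Λ := by
      refine mul_le_mul_of_nonneg_right (le_trans ?_ hKδ) hΛ0
      gcongr
      exact hδ s hs
    have h11 : ε / 2 * modEnergy N ε (u s) (w s) (v s) ≤ ε / 2 * (‖v s‖ ^ 2 + ‖w s‖ ^ 2) := by
      gcongr
    have h12 : ε / 2 * D s = 4 * Λ - ε / 2 * modEnergy N ε (u s) (w s) (v s) := by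
      simp only [D]
      rw [mul_sub, ← mul_assoc, hεK]
    change ‖f s‖ ^ 2 ≤ Λ at h3
    simp only [D']
    linarith
  by_contra hcon
  obtain ⟨T, hT0, hT, hTpos⟩ := exists_first_nonpos
    (fun s hs => (hD s hs).continuousWithinAt) ht (by simp only [D]; linarith)
  have hexp : ∀ s, 0 ≤ s → HasDerivWithinAt (fun s => -(D s * Real.exp (ε / 2 * s)))
      (-((D' s + ε / 2 * D s) * Real.exp (ε / 2 * s))) (Ici 0) s := by
    intro s hs
    have h2 : HasDerivAt (fun s => Real.exp (ε / 2 * s))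
        (Real.exp (ε / 2 * s) * (ε / 2 * 1)) s :=
      ((hasDerivAt_id s).const_mul (ε / 2)).exp
    refine ((hD s hs).mul h2.hasDerivWithinAt).neg.congr_deriv ?_
    ring
  have hle := le_of_hasDerivWithinAt_nonpos le_rfl hT0 hexp (fun s hs hsT => by
    have h1 := hDpos s hs.le (hTpos s hs.le hsT)
    rw [neg_nonpos]
    exact mul_nonneg (by linarith) (Real.exp_pos _).le)
  have hD0 : 0 < D 0 := sub_pos.2 h0
  rw [mul_zero, Real.exp_zero, mul_one, neg_le_neg_iff] at hle
  have := mul_nonpos_of_nonpos_of_nonneg hT (Real.exp_pos (ε / 2 * T)).le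
  linarith

/-- The derivative of |u|^{-p} is at most pL, so |u|^{-p} grows at most linearly. -/
theorem lower_bound_of_norm_deriv_le {H : Type*} [NormedAddCommGroup H] [InnerProductSpace ℝ H]
    {u v : ℝ → H} {p L ρ : ℝ} (hp : 0 < p) (hL : 0 ≤ L) (hρ : 0 < ρ)
    (hu : ∀ t, 0 ≤ t → HasDerivWithinAt u (v t) (Ici 0) t)
    (hv : ∀ t, 0 ≤ t → ‖v t‖ ≤ L * (‖u t‖ ^ p * ‖u t‖)) (hpos : ∀ t, 0 ≤ t → 0 < ‖u t‖)
    (h0 : ρ ≤ ‖u 0‖) {t : ℝ} (ht : 0 ≤ t) :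
    (ρ ^ (-p) + p * L) ^ (-(1 / p)) / (1 + t) ^ (1 / p) ≤ ‖u t‖ := by
  have hpow : ∀ s, (‖u s‖ ^ 2) ^ (-(p / 2)) = ‖u s‖ ^ (-p) := fun s => by
    rw [← Real.rpow_natCast, ← Real.rpow_mul (norm_nonneg _)]
    congr 1; push_cast; ring
  have hd : ∀ s, 0 ≤ s → HasDerivWithinAt (fun s => (‖u s‖ ^ 2) ^ (-(p / 2)) - p * L * s)
      (2 * ⟪u s, v s⟫ * -(p / 2) * (‖u s‖ ^ 2) ^ (-(p / 2) - 1) - p * L * 1) (Ici 0) s := by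
    intro s hs
    have h1 := (hu s hs).norm_sq.rpow_const (p := -(p / 2)) (Or.inl (by have := hpos s hs; positivity))
    exact h1.sub ((hasDerivAt_id s).const_mul (p * L)).hasDerivWithinAt
  have hle := le_of_hasDerivWithinAt_nonpos le_rfl ht hd (fun s hs _ => by
    have hup := hpos s hs.le
    have h1 := (abs_le.1 (abs_real_inner_le_norm (u s) (v s))).1
    have h2 : ‖u s‖ * ‖v s‖ ≤ ‖u s‖ * (L * (‖u s‖ ^ p * ‖u s‖)) := by gcongr; exact hv s hs.le
    have h3 : (‖u s‖ ^ 2) ^ (-(p / 2) - 1) * (‖u s‖ * (‖u s‖ ^ p * ‖u s‖)) = 1 := by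
      rw [Real.rpow_sub_one (by positivity), hpow, Real.rpow_neg hup.le]
      have : 0 < ‖u s‖ ^ p := by positivity
      field_simp
    have h4 : 0 ≤ (‖u s‖ ^ 2) ^ (-(p / 2) - 1) := by positivity
    have h5 : (‖u s‖ ^ 2) ^ (-(p / 2) - 1) * (-⟪u s, v s⟫) ≤
        (‖u s‖ ^ 2) ^ (-(p / 2) - 1) * (‖u s‖ * (L * (‖u s‖ ^ p * ‖u s‖))) := by
      gcongr; linarith
    have h6 : (‖u s‖ ^ 2) ^ (-(p / 2) - 1) * (‖u s‖ * (L * (‖u s‖ ^ p * ‖u s‖))) = L := by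
      linear_combination L * h3
    rw [h6] at h5
    have h7 := mul_le_mul_of_nonneg_left h5 hp.le
    linarith)
  rw [hpow, hpow, mul_zero, sub_zero] at hle
  have hut := hpos t ht
  have h1t : 0 < 1 + t := by linarith
  have h1 : ‖u 0‖ ^ (-p) ≤ ρ ^ (-p) := Real.rpow_le_rpow_of_nonpos hρ h0 (by linarith)
  have hρp : 0 < ρ ^ (-p) := by positivity
  set Q := ρ ^ (-p) + p * L with hQ
  have hQ0 : 0 < Q := by positivity
  have h2 : ‖u t‖ ^ (-p) ≤ Q * (1 + t) := by
    have : 0 ≤ ρ ^ (-p) * t := by positivity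
    have : 0 ≤ p * L := by positivity
    rw [hQ]; nlinarith
  have h3 : (Q * (1 + t)) ^ (-(1 / p)) ≤ (‖u t‖ ^ (-p)) ^ (-(1 / p)) :=
    Real.rpow_le_rpow_of_nonpos (by positivity) h2 (by rw [neg_nonpos]; positivity)
  rw [← Real.rpow_mul hut.le, show -p * -(1 / p) = 1 by field_simp, Real.rpow_one,
    Real.mul_rpow hQ0.le h1t.le, Real.rpow_neg h1t.le] at h3
  rwa [div_eq_mul_inv]

end SlowSolutions

/-! ### Weak solutions in D(A^{1/2}) and coercivity -/

section SqrtDomainLemmas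

open SqrtDomain

variable {H : Type*} [NormedAddCommGroup H] [InnerProductSpace ℝ H]

theorem inner_starProjection_starProjection (U : Submodule ℝ H) [U.HasOrthogonalProjection]
    (x y : H) : ⟪U.starProjection x, U.starProjection y⟫ = ⟪U.starProjection x, y⟫ := by
  have h := U.starProjection_inner_eq_zero y _ (U.starProjection_apply_mem x)
  rw [inner_sub_left, sub_eq_zero] at h
  rw [real_inner_comm, ← h, real_inner_comm]

variable [CompleteSpace H] {A : H →ₗ.[ℝ] H}

theorem toH_half_mem_graph (x : SqrtDomain A) : (toH A x, half A x) ∈ (sqrtOp A).graph :=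
  (sqrtOp A).mem_graph x

theorem exists_sqrtDomain_of_mem_graph {x y : H} (h : (x, y) ∈ (sqrtOp A).graph) :
    ∃ z : SqrtDomain A, toH A z = x ∧ half A z = y := by
  obtain ⟨z, hz, hz'⟩ := (LinearPMap.mem_graph_iff _).1 h
  exact ⟨z, hz, hz'⟩

theorem toH_injective : Function.Injective (toH A) := Subtype.val_injective

theorem continuous_toH : Continuous (toH A) :=
  AddMonoidHomClass.continuous_of_bound (toH A) 1 fun x => by
    rw [one_mul, norm_eq]
    exact Real.le_sqrt_of_sq_le (le_add_of_nonneg_right (sq_nonneg _))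

theorem continuous_half : Continuous (half A) :=
  AddMonoidHomClass.continuous_of_bound (half A) 1 fun x => by
    rw [one_mul, norm_eq]
    exact Real.le_sqrt_of_sq_le (le_add_of_nonneg_left (sq_nonneg _))

theorem isInducing_toGraph : IsInducing (toGraph A) := ⟨rfl⟩

theorem continuousOn_sqrtDomain {u : ℝ → SqrtDomain A} {s : Set ℝ}
    (h1 : ContinuousOn (fun t => toH A (u t)) s) (h2 : ContinuousOn (fun t => half A (u t)) s) :
    ContinuousOn u s :=
  isInducing_toGraph.continuousOn_iff.2
    ((WithLp.prodContinuousLinearEquiv 2 ℝ H H).symm.continuous.comp_continuousOn (h1.prodMk h2))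

variable {M : ClosedSubmodule ℝ H} {p : ℝ}

theorem IsWeakSolution.exists_isDampedWave (hp : 0 < p) {u₀ : SqrtDomain A} {u₁ : H}
    {u : ℝ → SqrtDomain A} (h : IsWeakSolution A (projNonlinearity M p) u₀ u₁ u) :
    ∃ v : ℝ → H, IsDampedWave (sqrtOp A) M.toSubmodule.starProjection p
      (fun t => toH A (u t)) (fun t => half A (u t)) v ∧ u 0 = u₀ ∧ v 0 = u₁ := by
  obtain ⟨hu, v, hv, hd, h0, h1, hw⟩ := h
  refine ⟨v, ⟨continuous_half.comp_continuousOn hu, hv, ?_, fun t _ => toH_half_mem_graph _, hd, ?_⟩,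
    h0, h1⟩
  · exact hv.neg.sub (((continuous_norm_rpow_smul hp).comp
      M.toSubmodule.starProjection.continuous).comp_continuousOn
        (continuous_toH.comp_continuousOn hu))
  · intro φ φ' hφ t ht
    obtain ⟨φ, rfl, rfl⟩ := exists_sqrtDomain_of_mem_graph hφ
    refine (hw φ t ht).congr_deriv ?_
    rw [inner_sub_left, inner_neg_left, projNonlinearity]
    ring

theorem IsDampedWave.exists_isWeakSolution {x w v : ℝ → H}
    (h : IsDampedWave (sqrtOp A) M.toSubmodule.starProjection p x w v) {u₀ : SqrtDomain A}
    (h0 : x 0 = toH A u₀) :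
    ∃ u : ℝ → SqrtDomain A, IsWeakSolution A (projNonlinearity M p) u₀ (v 0) u := by
  -- Membership in the domain is known only for t ≥ 0, so negative times are sent to 0.
  choose u hz hz' using fun t : ℝ =>
    exists_sqrtDomain_of_mem_graph (h.mem_graph (max t 0) (le_max_right t 0))
  have hu : ∀ t, 0 ≤ t → toH A (u t) = x t := fun t ht => (hz t).trans (by rw [max_eq_left ht])
  have hu' : ∀ t, 0 ≤ t → half A (u t) = w t := fun t ht => (hz' t).trans (by rw [max_eq_left ht])
  refine ⟨u, continuousOn_sqrtDomain (h.continuousOn_u.congr hu) (h.continuousOn_w.congr hu'),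
    v, h.continuousOn_v, fun t ht => ?_, ?_, rfl, fun φ t ht => ?_⟩
  · exact (h.hasDeriv_u t ht).congr (fun s hs => hu s hs) (hu t ht)
  · exact toH_injective ((hu 0 le_rfl).trans h0)
  · refine (h.hasDeriv_v _ _ (toH_half_mem_graph φ) t ht).congr_deriv ?_
    rw [hu t ht, hu' t ht, inner_sub_left, inner_neg_left, projNonlinearity]
    ring

/-- If Bx = y and By = Ax = 0, then |y|² = ⟨x, By⟩ = 0. -/
theorem mem_graph_sqrtOp_of_mem_opKer (hA : IsSelfAdjoint A) (hn : IsNonneg A) {x : H}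
    (hx : x ∈ opKer A) : (x, 0) ∈ (sqrtOp A).graph := by
  have hs := isNonnegSqrt_sqrtOp hA hn
  obtain ⟨hxd, hx0⟩ := mem_opKer.1 hx
  obtain ⟨y, h1, h2⟩ := (hs.graph_sq x 0).1 ((LinearPMap.mem_graph_iff _).2 ⟨⟨x, hxd⟩, rfl, hx0⟩)
  have h3 := inner_graph_of_isSelfAdjoint hs.selfAdjoint h1 h2
  rw [inner_zero_right, inner_self_eq_zero] at h3
  rwa [h3] at h1

theorem sq_norm_sub_starProjection_le (hA : IsSelfAdjoint A) (hn : IsNonneg A)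
    [FiniteDimensional ℝ (opKer A)] {ν : ℝ} (hν : 0 < ν)
    (hcoer : ∀ u : SqrtDomain A, toH A u ∈ (opKer A)ᗮ → ν * ‖toH A u‖ ^ 2 ≤ ‖half A u‖ ^ 2)
    {x y : H} (h : (x, y) ∈ (sqrtOp A).graph) :
    ‖x - (opKer A).starProjection x‖ ^ 2 ≤ 1 / ν * ‖y‖ ^ 2 := by
  have h1 := graph_sub h (mem_graph_sqrtOp_of_mem_opKer hA hn
    ((opKer A).starProjection_apply_mem x))
  rw [sub_zero] at h1
  obtain ⟨z, hz, rfl⟩ := exists_sqrtDomain_of_mem_graph h1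
  have h2 := hcoer z (by rw [hz]; exact Submodule.sub_starProjection_mem_orthogonal x)
  rw [hz] at h2
  rw [one_div_mul_eq_div, le_div_iff₀ hν]
  linarith

/-- P is injective on ker A, hence bounded below there by finite dimension; the spectral gap handles
the orthogonal component. -/
theorem exists_sq_norm_le (hA : IsSelfAdjoint A) (hn : IsNonneg A)
    [FiniteDimensional ℝ (opKer A)] {ν : ℝ} (hν : 0 < ν)
    (hcoer : ∀ u : SqrtDomain A, toH A u ∈ (opKer A)ᗮ → ν * ‖toH A u‖ ^ 2 ≤ ‖half A u‖ ^ 2)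
    (hM : M.toSubmoduleᗮ ⊓ opKer A = ⊥) :
    ∃ C₀ : ℝ, 0 < C₀ ∧ ∀ x y, (x, y) ∈ (sqrtOp A).graph →
      ‖x‖ ^ 2 ≤ C₀ * (‖y‖ ^ 2 + ‖M.toSubmodule.starProjection x‖ ^ 2) := by
  set P : H →L[ℝ] H := M.toSubmodule.starProjection with hP
  have hPn : ∀ x, ‖P x‖ ≤ ‖x‖ := fun x => M.toSubmodule.norm_starProjection_apply_le x
  let φ : opKer A →ₗ[ℝ] H := (P : H →ₗ[ℝ] H) ∘ₗ (opKer A).subtype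
  have hφ : LinearMap.ker φ = ⊥ := by
    rw [LinearMap.ker_eq_bot']
    intro n hn0
    have h1 : (n : H) ∈ M.toSubmoduleᗮ := (Submodule.starProjection_apply_eq_zero_iff _).1 hn0
    have h2 : (n : H) ∈ M.toSubmoduleᗮ ⊓ opKer A := ⟨h1, n.2⟩
    rw [hM, Submodule.mem_bot] at h2
    exact Subtype.ext h2
  obtain ⟨K, hK0, hK⟩ := φ.exists_antilipschitzWith hφ
  have hKn : ∀ n ∈ opKer A, ‖n‖ ≤ K * ‖P n‖ := fun n hn => by
    have := hK.le_mul_dist (⟨n, hn⟩ : opKer A) 0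
    rwa [map_zero, dist_zero_right, dist_zero_right] at this
  refine ⟨2 * (K : ℝ) ^ 2 + 2 * (K + 1) ^ 2 * (1 / ν), by positivity, fun x y h => ?_⟩
  have h1 := sq_norm_sub_starProjection_le hA hn hν hcoer h
  have h2 := hKn _ ((opKer A).starProjection_apply_mem x)
  set n := (opKer A).starProjection x
  have h3 : ‖P n‖ ≤ ‖P x‖ + ‖x - n‖ := by
    have : P n = P x - P (x - n) := by rw [← map_sub]; congr 1; abel
    rw [this]
    exact (norm_sub_le _ _).trans (by gcongr; exact hPn _)
  have h4 : ‖x‖ ≤ ‖n‖ + ‖x - n‖ := by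
    have := norm_add_le n (x - n)
    rwa [add_sub_cancel] at this
  have h5 : (K : ℝ) * ‖P n‖ ≤ K * (‖P x‖ + ‖x - n‖) := by gcongr
  have h6 : ‖x‖ ≤ K * ‖P x‖ + (K + 1) * ‖x - n‖ := by linarith
  have h7 : ‖x‖ ^ 2 ≤ (K * ‖P x‖ + (K + 1) * ‖x - n‖) ^ 2 := by gcongr
  have h8 : 2 * ((K : ℝ) + 1) ^ 2 * ‖x - n‖ ^ 2 ≤ 2 * (K + 1) ^ 2 * (1 / ν * ‖y‖ ^ 2) := by gcongr
  have h9 : 0 ≤ 2 * (K : ℝ) ^ 2 * ‖y‖ ^ 2 := by positivity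
  have h10 : 0 ≤ 2 * ((K : ℝ) + 1) ^ 2 * (1 / ν) * ‖P x‖ ^ 2 := by positivity
  nlinarith [sq_nonneg ((K : ℝ) * ‖P x‖ - (K + 1) * ‖x - n‖)]

end SqrtDomainLemmas

/-! ### The open set of slow initial data -/

section SlowSet

open SqrtDomain

variable {H : Type*} [NormedAddCommGroup H] [InnerProductSpace ℝ H] [CompleteSpace H]

/-- The left side is the bound of `sq_norm_le_of_energy_le`: energy below η keeps |u| ≤ δ at all
times. -/
theorem exists_pos_small {C₀ p δ : ℝ} (hp : 0 < p) (hδ : 0 < δ) :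
    ∃ η : ℝ, 0 < η ∧ C₀ * (2 * η + ((p + 2) * η) ^ (2 / (p + 2))) ≤ δ ^ 2 := by
  have hc : ContinuousAt (fun η : ℝ => C₀ * (2 * η + ((p + 2) * η) ^ (2 / (p + 2)))) 0 := by
    refine continuousAt_const.mul ((continuousAt_const.mul continuousAt_id).add ?_)
    exact (continuousAt_const.mul continuousAt_id).rpow_const (Or.inr (by positivity))
  have h0 : C₀ * (2 * 0 + ((p + 2) * 0) ^ (2 / (p + 2))) < δ ^ 2 := by
    rw [mul_zero, mul_zero, Real.zero_rpow (by positivity), add_zero, mul_zero]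
    positivity
  have h1 := (hc.eventually (eventually_lt_nhds h0)).filter_mono
    (nhdsWithin_le_nhds (s := Ioi (0 : ℝ)))
  obtain ⟨η, hη, hη0⟩ := (h1.and self_mem_nhdsWithin).exists
  exact ⟨η, hη0, hη.le⟩

theorem exists_small_delta {K p : ℝ} (hp : 0 < p) (hK : 0 < K) :
    ∃ δ : ℝ, 0 < δ ∧ K * ((4 * p + 4) * √K * δ ^ p) ≤ 2 := by
  refine ⟨(2 / (K * ((4 * p + 4) * √K))) ^ (1 / p), by positivity, ?_⟩
  rw [← Real.rpow_mul (by positivity), one_div_mul_cancel hp.ne', Real.rpow_one]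
  refine le_of_eq ?_
  field_simp

/-- Initial data of small energy, away from zero, and dominated by their kernel component. -/
def slowSet (A : H →ₗ.[ℝ] H) (P N : H →L[ℝ] H) (p ε K η ρ : ℝ) : Set (SqrtDomain A × H) :=
  {z | energy P p (toH A z.1) (half A z.1) z.2 < η ∧ ρ < ‖toH A z.1‖ ∧
    modEnergy N ε (toH A z.1) (half A z.1) z.2 < K * ‖toH A z.1‖ ^ (2 * p + 2)}

theorem isOpen_slowSet (A : H →ₗ.[ℝ] H) (P N : H →L[ℝ] H) {p : ℝ} (hp : 0 < p) (ε K η ρ : ℝ) :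
    IsOpen (slowSet A P N p ε K η ρ) := by
  have h1 : Continuous fun z : SqrtDomain A × H => toH A z.1 := continuous_toH.comp continuous_fst
  have h2 : Continuous fun z : SqrtDomain A × H => half A z.1 := continuous_half.comp continuous_fst
  have h3 : Continuous fun z : SqrtDomain A × H => z.2 := continuous_snd
  have h4 : Continuous fun z : SqrtDomain A × H => energy P p (toH A z.1) (half A z.1) z.2 :=
    (((h3.norm.pow 2).add (h2.norm.pow 2)).div_const 2).add
      (((P.continuous.comp h1).norm.rpow_const fun _ => Or.inr (by positivity)).div_const _)
  have h5 : Continuous fun z : SqrtDomain A × H => modEnergy N ε (toH A z.1) (half A z.1) z.2 :=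
    (((h3.norm.pow 2).add (h2.norm.pow 2)).div_const 2).add
      (continuous_const.mul ((h1.sub (N.continuous.comp h1)).inner h3))
  have h6 : Continuous fun z : SqrtDomain A × H => K * ‖toH A z.1‖ ^ (2 * p + 2) :=
    continuous_const.mul (h1.norm.rpow_const fun _ => Or.inr (by positivity))
  exact (isOpen_lt h4 continuous_const).and
    ((isOpen_lt continuous_const h1.norm).and (isOpen_lt h5 h6))

end SlowSet

end DampedWave

end

/-! ### Assembly of the theorem -/

theorem theorem4p4
    {H : Type*} [NormedAddCommGroup H] [InnerProductSpace ℝ H] [CompleteSpace H]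
    (A : H →ₗ.[ℝ] H)
    (hA_sa : IsSelfAdjoint A)
    (hA_nonneg : DampedWave.IsNonneg A)
    (hA_ker : DampedWave.opKer A ≠ ⊥)
    (hA_coercive : ∃ ν : ℝ, 0 < ν ∧ ∀ u : DampedWave.SqrtDomain A,
      DampedWave.SqrtDomain.toH A u ∈ (DampedWave.opKer A)ᗮ →
        ν * ‖DampedWave.SqrtDomain.toH A u‖ ^ 2 ≤ ‖DampedWave.SqrtDomain.half A u‖ ^ 2)
    (hA_dim : FiniteDimensional ℝ (DampedWave.opKer A))
    (M : ClosedSubmodule ℝ H)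
    (hM : M.toSubmoduleᗮ ⊓ DampedWave.opKer A = ⊥)
    (p : ℝ) (hp : 0 < p) :
    -- existence, uniqueness and decay of all weak solutions
    (∀ (u₀ : DampedWave.SqrtDomain A) (u₁ : H),
      ∃ u : ℝ → DampedWave.SqrtDomain A,
        DampedWave.IsWeakSolution A (DampedWave.projNonlinearity M p) u₀ u₁ u ∧
        (∀ w : ℝ → DampedWave.SqrtDomain A,
          DampedWave.IsWeakSolution A (DampedWave.projNonlinearity M p) u₀ u₁ w →
            Set.EqOn w u (Set.Ici 0)) ∧
        ∃ M₁ : ℝ, ∀ t : ℝ, 0 ≤ t →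
          ‖DampedWave.SqrtDomain.toH A (u t)‖ ≤ M₁ / (1 + t) ^ (1 / p)) ∧
    -- existence of an open set of slow solutions
    (∃ S : Set (DampedWave.SqrtDomain A × H), IsOpen S ∧ S.Nonempty ∧
      ∃ M₂ M₃ : ℝ, 0 < M₂ ∧ 0 < M₃ ∧
        ∀ (u₀ : DampedWave.SqrtDomain A) (u₁ : H), (u₀, u₁) ∈ S →
          ∀ u : ℝ → DampedWave.SqrtDomain A,
            DampedWave.IsWeakSolution A (DampedWave.projNonlinearity M p) u₀ u₁ u →
              ∀ t : ℝ, 0 ≤ t →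
                M₂ / (1 + t) ^ (1 / p) ≤ ‖DampedWave.SqrtDomain.toH A (u t)‖ ∧
                ‖DampedWave.SqrtDomain.toH A (u t)‖ ≤ M₃ / (1 + t) ^ (1 / p)) := by
  open DampedWave SqrtDomain in
  obtain ⟨ν, hν, hcoer⟩ := hA_coercive
  have hB := (isNonnegSqrt_sqrtOp hA_sa hA_nonneg).selfAdjoint
  obtain ⟨C₀, hC₀, hcoer₀⟩ := exists_sq_norm_le hA_sa hA_nonneg hν hcoer hM
  set P : H →L[ℝ] H := M.toSubmodule.starProjection with hPdef
  have hPn : ∀ x, ‖P x‖ ≤ ‖x‖ := fun x => M.toSubmodule.norm_starProjection_apply_le x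
  have hP : ∀ x y, ⟪P x, P y⟫ = ⟪P x, y⟫ := inner_starProjection_starProjection M.toSubmodule
  refine ⟨fun u₀ u₁ => ?_, ?_⟩
  · obtain ⟨x, w, v, h, hx0, rfl⟩ :=
      exists_isDampedWave hB hp hPn hP (toH_half_mem_graph u₀) u₁
    obtain ⟨u, hu⟩ := h.exists_isWeakSolution hx0
    refine ⟨u, hu, fun y hy t ht => ?_, ?_⟩
    · obtain ⟨v₁, h₁, h₁0, h₁1⟩ := hy.exists_isDampedWave hp
      obtain ⟨v₂, h₂, h₂0, h₂1⟩ := hu.exists_isDampedWave hp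
      exact toH_injective (h₁.eqOn hB hp hPn h₂ (by rw [h₁0, h₂0]) (by rw [h₁1, h₂1]) ht)
    · obtain ⟨v₂, h₂, h₂0, h₂1⟩ := hu.exists_isDampedWave hp
      obtain ⟨M₁, -, hM₁⟩ := exists_decay_bound hB hp hP hC₀ hcoer₀
        (ρ := max (energy P p (toH A (u 0)) (half A (u 0)) (v₂ 0)) (‖toH A (u 0)‖ ^ 2))
        (le_max_of_le_right (sq_nonneg _))
      exact ⟨M₁, hM₁ _ _ _ h₂ (le_max_left _ _) (le_max_right _ _)⟩
  · set N : H →L[ℝ] H := (opKer A).starProjection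
    have hN : ∀ x, (N x, (0 : H)) ∈ (sqrtOp A).graph := fun x =>
      mem_graph_sqrtOp_of_mem_opKer hA_sa hA_nonneg ((opKer A).starProjection_apply_mem x)
    have hNpos : ∀ x, 0 ≤ ⟪N x, x⟫ := fun x => by
      rw [← inner_starProjection_starProjection]; exact real_inner_self_nonneg
    have hκ : 0 < 1 / ν := by positivity
    have hNcoer : ∀ x y, (x, y) ∈ (sqrtOp A).graph → ‖x - N x‖ ^ 2 ≤ 1 / ν * ‖y‖ ^ 2 :=
      fun x y h => sq_norm_sub_starProjection_le hA_sa hA_nonneg hν hcoer h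
    obtain ⟨ε, hε, hεκ⟩ : ∃ ε : ℝ, 0 < ε ∧ ε * (1 + 1 / ν) ≤ 1 / 4 :=
      ⟨1 / 4 / (1 + 1 / ν), by positivity, (div_mul_cancel₀ _ (by positivity)).le⟩
    obtain ⟨K, hK⟩ : ∃ K : ℝ, K = 8 / ε := ⟨_, rfl⟩
    have hK0 : 0 < K := by rw [hK]; positivity
    obtain ⟨δ, hδ, hKδ⟩ := exists_small_delta hp hK0
    obtain ⟨η, hη, hηδ⟩ := exists_pos_small (C₀ := C₀) hp hδ
    -- A kernel vector of norm τ at rest has energy at most η/(p+2) < η and modified energy 0, so it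
    -- lies in the slow set.
    obtain ⟨τ, hτ, hτη⟩ : ∃ τ : ℝ, 0 < τ ∧ τ ^ (p + 2) = η :=
      ⟨η ^ (1 / (p + 2)), by positivity, by
        rw [← Real.rpow_mul hη.le, one_div_mul_cancel (by positivity), Real.rpow_one]⟩
    obtain ⟨M₃, hM₃, hupper⟩ := exists_decay_bound hB hp hP hC₀ hcoer₀ (ρ := max η (δ ^ 2))
      (le_max_of_le_left hη.le)
    refine ⟨slowSet A P N p ε K η (τ / 2), isOpen_slowSet A P N hp ε K η (τ / 2), ?_,
      ((τ / 2) ^ (-p) + p * (2 * √K)) ^ (-(1 / p)), M₃, by positivity, hM₃,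
      fun u₀ u₁ hS u hu t ht => ?_⟩
    · obtain ⟨n, hn, hn0⟩ := (Submodule.ne_bot_iff _).1 hA_ker
      have hx := mem_graph_sqrtOp_of_mem_opKer hA_sa hA_nonneg
        ((opKer A).smul_mem (τ / ‖n‖) hn)
      obtain ⟨z, hz, hz'⟩ := exists_sqrtDomain_of_mem_graph hx
      have hzn : ‖toH A z‖ = τ := by
        rw [hz, norm_smul, Real.norm_of_nonneg (by positivity),
          div_mul_cancel₀ _ (norm_ne_zero_iff.2 hn0)]
      refine ⟨(z, 0), ?_, ?_, ?_⟩
      · simp only [energy, hz', norm_zero]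
        have h1 : ‖P (toH A z)‖ ^ (p + 2) ≤ τ ^ (p + 2) := by
          gcongr; exact (hPn _).trans hzn.le
        rw [hτη] at h1
        have h2 : ‖P (toH A z)‖ ^ (p + 2) / (p + 2) < η := by
          rw [div_lt_iff₀ (by positivity)]; nlinarith
        simpa using h2
      · rw [hzn]; linarith
      · simp only [modEnergy, hz', norm_zero, inner_zero_right]
        rw [hzn]
        simp only [ne_eq, OfNat.ofNat_ne_zero, not_false_eq_true, zero_pow, add_zero, zero_div,
          mul_zero]
        positivity
    · obtain ⟨v, h, rfl, rfl⟩ := hu.exists_isDampedWave hp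
      obtain ⟨hS1, hS2, hS3⟩ := hS
      have hsmall : ∀ s, 0 ≤ s → ‖toH A (u s)‖ ≤ δ := fun s hs =>
        le_of_sq_le_sq ((sq_norm_le_of_energy_le hp hC₀.le (hcoer₀ _ _ (h.mem_graph s hs))
          ((h.energy_le hB hp hP hs).trans hS1.le)).trans hηδ) hδ.le
      have hmod : ∀ s, 0 ≤ s → modEnergy N ε (toH A (u s)) (half A (u s)) (v s) <
          K * ‖toH A (u s)‖ ^ (2 * p + 2) := fun s hs =>
        h.modEnergy_lt hB hp hPn hN hNpos hκ hε hεκ hNcoer hK hKδ hsmall hS3 hs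
      have hgs : ∀ s, 0 ≤ s → ‖toH A (u s) - N (toH A (u s))‖ ^ 2 ≤ 1 / ν * ‖half A (u s)‖ ^ 2 :=
        fun s hs => hNcoer _ _ (h.mem_graph s hs)
      refine ⟨lower_bound_of_norm_deriv_le hp (by positivity) (by positivity) h.hasDeriv_u
        (fun s hs => norm_le_of_modEnergy_lt hp hκ hε hεκ hK0 (hgs s hs) (hmod s hs))
        (fun s hs => ?_) hS2.le ht, ?_⟩
      -- At a zero of u the invariant inequality would make the modified energy negative, although
      -- it dominates (|v|² + |w|²)/4.
      · by_contra! h0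
        have h1 := (modEnergy_bounds hκ hε hεκ (v := v s) (hgs s hs)).1
        have h2 := hmod s hs
        rw [le_antisymm h0 (norm_nonneg _), Real.zero_rpow (by positivity), mul_zero] at h2
        have h3 : 0 ≤ (‖v s‖ ^ 2 + ‖half A (u s)‖ ^ 2) / 4 := by positivity
        linarith
      · exact hupper _ _ _ h (hS1.le.trans (le_max_left _ _))
          (le_max_of_le_right (pow_le_pow_left₀ (norm_nonneg _) (hsmall 0 le_rfl) 2)) t ht
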